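/- Let $G$ be a (Hausdorff) locally compact group. A \emph{convex compact $G$-space} is a convex compact subset $K$ of a Hausdorff locally convex real topological vector space, endowed with a representation of $G$ by continuous affine maps preserving $K$ and such that the action $G\times K\to K$ is continuous. A topological group is \emph{amenable} if it fixes a point in every non-empty convex compact space on which it acts in this way. A closed subgroup $H<G$ is \emph{relatively amenable} if $H$ fixes a point in every non-empty convex compact $G$-space, and $\mathscr{X}$ denotes the class of locally compact groups in which every relatively amenable closed subgroup is amenable. The \emph{Chabauty topology} on the set of closed subgroups of $G$ is generated by the sets $\{L : L\cap C=\varnothing\}$ with $C\subseteq G$ compact and $\{L : L\cap U\neq\varnothing\}$ with $U\subseteq G$ open. A closed subgroup $H<G$ satisfies \emph{Derighetti's condition} if the trivial representation of $H$ is weakly contained in the restriction to $H$ of the quasi-regular representation of $G$ on $L^2(G/H)$ (formed with a quasi-invariant Radon measure on $G/H$), i.e. if for every compact $Q\subseteq H$ and every $\varepsilon>0$ there is a unit vector $f\in L^2(G/H)$ with $\|\pi(h)f-f\|_2\le\varepsilon$ for all $h\in Q$. Let $H<G$ be a closed subgroup which is a Chabauty limit of amenable closed subgroups of $G$, i.e.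 lies in the Chabauty closure of the set of amenable closed subgroups of $G$. Then $H$ is amenable provided that at least one of the following conditions holds: (i) $G$ belongs to $\mathscr{X}$; (ii) $H<G$ satisfies Derighetti's condition. Moreover, every closed subgroup $H<G$ that is open or normal satisfies Derighetti's condition. -/

import Mathlib

open MeasureTheory Set Topology

universe u

section ConvexCompactSpaces

/-- `K` is a convex compact `G`-space: a convex compact subset of the topological vector space `E`
on which `G` acts by continuous affine maps preserving `K`, the action `G × K → K` being
(jointly) continuous. Continuity is asked on `K` only, as for weak-* topologies; non-emptiness is
not part of the definition. -/
structure IsConvexCompactGSpace {G : Type*} [Group G] [TopologicalSpace G]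
    {E : Type*} [AddCommGroup E] [Module ℝ E] [TopologicalSpace E]
    (ρ : G →* (E →ᵃ[ℝ] E)) (K : Set E) : Prop where
  convex : Convex ℝ K
  isCompact : IsCompact K
  continuous_apply : ∀ g : G, Continuous (ρ g)
  mapsTo : ∀ g : G, MapsTo (ρ g) K K
  continuousOn : ContinuousOn (fun p : G × E => ρ p.1 p.2) (univ ×ˢ K)

/-- Amenability of a topological group: `G` fixes a point in every non-empty convex compact
`G`-space in a Hausdorff locally convex space. The spaces are taken in the universe of `G`; since
`E` may be the dual of a space of bounded continuous functions on `G`, this is no restriction. -/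
def IsAmenableGroup (G : Type u) [Group G] [TopologicalSpace G] : Prop :=
  ∀ (E : Type u) [AddCommGroup E] [Module ℝ E] [TopologicalSpace E] [IsTopologicalAddGroup E]
    [ContinuousSMul ℝ E] [LocallyConvexSpace ℝ E] [T2Space E]
    (ρ : G →* (E →ᵃ[ℝ] E)) (K : Set E),
    IsConvexCompactGSpace ρ K → K.Nonempty → ∃ x ∈ K, ∀ g : G, ρ g x = x

/-- Amenability of the subgroup `H` relative to `G`: `H` fixes a point in every non-empty convex
compact `G`-space. -/
def IsRelativelyAmenable {G : Type u} [Group G] [TopologicalSpace G] (H : Subgroup G) : Prop :=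
  ∀ (E : Type u) [AddCommGroup E] [Module ℝ E] [TopologicalSpace E] [IsTopologicalAddGroup E]
    [ContinuousSMul ℝ E] [LocallyConvexSpace ℝ E] [T2Space E]
    (ρ : G →* (E →ᵃ[ℝ] E)) (K : Set E),
    IsConvexCompactGSpace ρ K → K.Nonempty → ∃ x ∈ K, ∀ h ∈ H, ρ h x = x

/-- The class `𝒳`: every relatively amenable closed subgroup of `G` is amenable
(in its subspace topology). -/
def InClassX (G : Type u) [Group G] [TopologicalSpace G] : Prop :=
  ∀ H : ClosedSubgroup G, IsRelativelyAmenable H.toSubgroup → IsAmenableGroup H.toSubgroup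

end ConvexCompactSpaces

section Chabauty

/-- The Chabauty topology on the space of closed subgroups of `G`, generated by the sets
`{L | L ∩ C = ∅}` with `C` compact and `{L | L ∩ U ≠ ∅}` with `U` open. -/
instance chabautyTopology (G : Type*) [Group G] [TopologicalSpace G] :
    TopologicalSpace (ClosedSubgroup G) :=
  TopologicalSpace.generateFrom
    ({S | ∃ C : Set G, IsCompact C ∧ S = {L : ClosedSubgroup G | (L : Set G) ∩ C = ∅}} ∪
      {S | ∃ U : Set G, IsOpen U ∧ S = {L : ClosedSubgroup G | ((L : Set G) ∩ U).Nonempty}})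

end Chabauty

section Derighetti

/-- `μ` is a non-zero (strongly) quasi-invariant Radon measure on the `G`-space `X`, with
continuous positive Radon-Nikodym cocycle `lam`: the translate `A ↦ μ (g A)` of `μ` is the Radon
measure `lam g · μ`. On `X = G ⧸ H`, with `G` locally compact and `H` closed, such a pair exists,
and `μ` is unique up to multiplication by a continuous positive density. -/
structure IsQuasiInvariant {G X : Type*} [Group G] [TopologicalSpace G] [TopologicalSpace X]
    [MulAction G X] [MeasurableSpace X] [BorelSpace X] (μ : Measure X) (lam : G → X → ℝ) :
    Prop where
  regular : μ.Regular
  ne_zero : μ ≠ 0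
  continuous : Continuous (fun p : G × X => lam p.1 p.2)
  pos : ∀ g x, 0 < lam g x
  integral_smul : ∀ (g : G) (f : X → ℝ), Continuous f → HasCompactSupport f →
    ∫ x, f (g⁻¹ • x) ∂μ = ∫ x, f x * lam g x ∂μ

/-- The quasi-regular representation associated with `μ` and `lam` as above,
`(π(g) f)(x) = √(d(gμ)/dμ (x)) f(g⁻¹ x)`, on functions representing elements of `L²(X, μ)`. -/
noncomputable def quasiRegular {G X : Type*} [Group G] [MulAction G X] (lam : G → X → ℝ)
    (g : G) (f : X → ℝ) : X → ℝ :=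
  fun x => √(lam g⁻¹ x) * f (g⁻¹ • x)

/-- Derighetti's condition for `H < G`: the trivial representation of `H` is weakly contained in
the restriction to `H` of the quasi-regular representation of `G` on `L²(G ⧸ H)`, that is, the
latter has `(Q, ε)`-invariant unit vectors for all compact `Q ⊆ H` and all `ε > 0`. -/
def DerighettiCondition {G : Type*} [Group G] [TopologicalSpace G] (H : Subgroup G) : Prop :=
  letI : MeasurableSpace (G ⧸ H) := borel (G ⧸ H)
  haveI : BorelSpace (G ⧸ H) := ⟨rfl⟩
  ∃ (μ : Measure (G ⧸ H)) (lam : G → G ⧸ H → ℝ), IsQuasiInvariant μ lam ∧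
    ∀ Q : Set G, Q ⊆ H → IsCompact Q → ∀ ε : ℝ, 0 < ε →
      ∃ f : G ⧸ H → ℝ, MemLp f 2 μ ∧ eLpNorm f 2 μ = 1 ∧
        ∀ h ∈ Q, eLpNorm (quasiRegular lam h f - f) 2 μ ≤ ENNReal.ofReal ε

end Derighetti

/-!
The proof reduces everything to relative amenability. If `H` is a Chabauty limit of amenable closed
subgroups, then `H` is relatively amenable (`isRelativelyAmenable_of_mem_closure`): in a convex
compact `G`-space the approximating subgroups have fixed points, and by compactness and continuity
of the action these accumulate at a point fixed by `H`. This settles the case of the class `𝒳`.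

Under Derighetti's condition a relatively amenable closed subgroup `H` is amenable
(`IsRelativelyAmenable.isAmenableGroup`). Let `K` be a convex compact `H`-space. The induced space
of `H`-equivariant measurable maps `F : G → K` modulo null sets is a convex compact `G`-space for
right translations, so it contains a map `F` fixed by `H`, that is, an `H`-equivariant map
`F : G ⧸ H → K`. If `f ∈ L²(G ⧸ H)` is an almost `H`-invariant unit vector, then the barycenter of
the image under `F` of the probability measure with density `f²` is an almost `H`-fixed point of
`K`, and compactness yields a fixed point.

No measurable maps into `K` are used. A map `F` is encoded by the linear map
`T u = ∫ u F ∂ν` on compactly supported continuous functions, where `ν` is a right Haar measure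
(`IsMeanMap`, `inducedSet`), so that compactness is Tychonoff's theorem and joint continuity of the
action is the continuity of translations in `L¹` (`isConvexCompactGSpace_inducedSet`). The induced
space is non-empty because the orbit map of a point of `K` can be averaged over `H` with
compactly supported weights (`inducedSet_nonempty`). As `F` itself has no values, it is smoothed
by a density `ω` near the identity of `G`: the map `quotientMap T ω : G ⧸ H → K` is continuous,
and an element `h` of `H` carries it to the map of the conjugate density
(`equivariant_quotientMap`). Its average against a fixed almost invariant density on `G ⧸ H`
hardly depends on `ω`, as a comparison of `ω` and `ω'` with their convolution shows
(`IsMeanMap.abs_integral_quotientMap_convolutionCc_sub_le`,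
`exists_nhds_integral_abs_convolutionCc_sub_le`).

An open or normal subgroup acts on `G ⧸ H` fixing the base point, respectively all points, so
the indicator function of a suitable set of measure one is an invariant unit vector.
-/

/-! ### Barycenters in compact convex sets -/

section Barycenter

theorem integrable_mul_of_hasCompactSupport {X : Type*} [TopologicalSpace X] [MeasurableSpace X]
    [OpensMeasurableSpace X] {μ : Measure X} [IsFiniteMeasureOnCompacts μ] {w F : X → ℝ}
    (hw : Continuous w) (hwc : HasCompactSupport w) (hF : Continuous F) :
    Integrable (fun x => w x * F x) μ :=
  (hw.mul hF).integrable_of_hasCompactSupport hwc.mul_right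

variable {E : Type*} [AddCommGroup E] [Module ℝ E] [TopologicalSpace E]

/-- A linear functional on the dual which is dominated by the support function of a compact convex
set `K` is the evaluation at a point of `K`. By compactness, only finitely many
elements of the dual have to be treated at a time, and these are handled by separation in a
finite-dimensional space. -/
theorem exists_mem_forall_eq_of_le_support {K : Set E} (hK : Convex ℝ K) (hKc : IsCompact K)
    (Λ : (E →L[ℝ] ℝ) →ₗ[ℝ] ℝ) (hΛ : ∀ (φ : E →L[ℝ] ℝ) (a : ℝ), (∀ x ∈ K, φ x ≤ a) → Λ φ ≤ a) :
    ∃ x ∈ K, ∀ φ : E →L[ℝ] ℝ, φ x = Λ φ := by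
  classical
  have key := hKc.inter_iInter_nonempty (fun φ : E →L[ℝ] ℝ => {x | φ x = Λ φ})
    (fun φ => isClosed_eq φ.continuous continuous_const) ?_
  · obtain ⟨x, hx, hx'⟩ := key
    exact ⟨x, hx, fun φ => mem_iInter.1 hx' φ⟩
  intro s
  let ev : E →L[ℝ] (s → ℝ) := ContinuousLinearMap.pi fun φ => (φ : E →L[ℝ] ℝ)
  by_cases hmem : (fun φ : s => Λ φ) ∈ ev '' K
  · obtain ⟨x, hx, hxe⟩ := hmem
    refine ⟨x, hx, mem_iInter₂.2 fun φ hφ => ?_⟩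
    exact congrFun hxe ⟨φ, hφ⟩
  · exfalso
    obtain ⟨f, a, hfa, haf⟩ := geometric_hahn_banach_closed_point
      (hK.linear_image ev.toLinearMap) (hKc.image ev.continuous).isClosed hmem
    let e : s → ℝ := fun i => f fun j => if i = j then 1 else 0
    have hf : ∀ v : s → ℝ, f v = ∑ i, v i * e i := fun v => by
      simpa using LinearMap.pi_apply_eq_sum_univ f.toLinearMap v
    let ψ : E →L[ℝ] ℝ := ∑ i : s, e i • (i : E →L[ℝ] ℝ)
    have h1 : Λ ψ ≤ a := hΛ ψ a fun x hx => by
      have := hfa (ev x) (mem_image_of_mem _ hx)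
      rw [hf] at this
      refine le_trans (le_of_eq ?_) this.le
      simp [ψ, ev, mul_comm]
    rw [hf] at haf
    have h2 : Λ ψ = ∑ i : s, Λ i * e i := by simp [ψ, map_sum, mul_comm]
    linarith

theorem exists_forall_mem_abs_le {K : Set E} (hKc : IsCompact K) (φ : E →L[ℝ] ℝ) :
    ∃ C : ℝ, 0 ≤ C ∧ ∀ x ∈ K, |φ x| ≤ C := by
  obtain ⟨C, hC⟩ := hKc.exists_bound_of_continuousOn φ.continuous.continuousOn
  exact ⟨max C 0, le_max_right _ _, fun x hx => (hC x hx).trans (le_max_left _ _)⟩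

variable {X : Type*} [TopologicalSpace X] [MeasurableSpace X] [BorelSpace X]

/-- The weak integral of a `K`-valued map, where `K` is compact and convex, against a non-negative
continuous weight of compact support. -/
theorem exists_weak_integral {K : Set E} (hK : Convex ℝ K) (hKc : IsCompact K) (hKn : K.Nonempty)
    (μ : Measure X) [IsFiniteMeasureOnCompacts μ] {F : X → E} (hFK : ∀ x, F x ∈ K)
    (hF : ∀ φ : E →L[ℝ] ℝ, Continuous fun x => φ (F x)) {w : X → ℝ} (hw : Continuous w)
    (hwc : HasCompactSupport w) (hw0 : ∀ x, 0 ≤ w x) :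
    ∃ y ∈ K, ∀ φ : E →L[ℝ] ℝ, φ ((∫ x, w x ∂μ) • y) = ∫ x, w x * φ (F x) ∂μ := by
  have hint : ∀ φ : E →L[ℝ] ℝ, Integrable (fun x => w x * φ (F x)) μ := fun φ =>
    integrable_mul_of_hasCompactSupport hw hwc (hF φ)
  have hwi : Integrable w μ := hw.integrable_of_hasCompactSupport hwc
  rcases (integral_nonneg hw0 : 0 ≤ ∫ x, w x ∂μ).eq_or_lt with h0 | h0
  · obtain ⟨y, hy⟩ := hKn
    refine ⟨y, hy, fun φ => ?_⟩
    obtain ⟨C, hC0, hC⟩ := exists_forall_mem_abs_le hKc φ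
    have : |∫ x, w x * φ (F x) ∂μ| ≤ ∫ x, w x * C ∂μ := by
      refine (abs_integral_le_integral_abs).trans (integral_mono (hint φ).abs (hwi.mul_const C) ?_)
      intro x
      simp only [abs_mul, abs_of_nonneg (hw0 x)]
      exact mul_le_mul_of_nonneg_left (hC _ (hFK x)) (hw0 x)
    rw [integral_mul_const, ← h0, zero_mul] at this
    rw [← h0, zero_smul, map_zero, abs_nonpos_iff.1 this]
  · let Λ : (E →L[ℝ] ℝ) →ₗ[ℝ] ℝ :=
      { toFun := fun φ => (∫ x, w x ∂μ)⁻¹ * ∫ x, w x * φ (F x) ∂μ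
        map_add' := fun φ ψ => by
          rw [← mul_add, ← integral_add (hint φ) (hint ψ)]
          simp only [add_apply, mul_add]
        map_smul' := fun a φ => by
          simp only [smul_apply, smul_eq_mul, RingHom.id_apply, mul_left_comm _ a,
            integral_const_mul] }
    obtain ⟨y, hy, hyΛ⟩ := exists_mem_forall_eq_of_le_support hK hKc Λ fun φ a ha => by
      have : ∫ x, w x * φ (F x) ∂μ ≤ ∫ x, w x * a ∂μ :=
        integral_mono (hint φ) (hwi.mul_const a) fun x =>
          mul_le_mul_of_nonneg_left (ha _ (hFK x)) (hw0 x)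
      rw [integral_mul_const] at this
      change (∫ x, w x ∂μ)⁻¹ * ∫ x, w x * φ (F x) ∂μ ≤ a
      rwa [inv_mul_le_iff₀ h0]
    refine ⟨y, hy, fun φ => ?_⟩
    rw [map_smul, hyΛ, smul_eq_mul]
    exact mul_inv_cancel_left₀ h0.ne' _

variable [IsTopologicalAddGroup E]

/-- A functional composed with a continuous affine self-map is a functional plus a constant. -/
theorem exists_functional_comp_affine (φ : E →L[ℝ] ℝ) (A : E →ᵃ[ℝ] E) (hA : Continuous A) :
    ∃ (ψ : E →L[ℝ] ℝ) (a : ℝ), ∀ x, φ (A x) = ψ x + a := by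
  refine ⟨φ.comp ⟨A.linear, AffineMap.continuous_linear_iff.2 hA⟩, φ (A 0), fun x => ?_⟩
  have : A x = A.linear x + A 0 := by
    rw [A.decomp]; simp
  rw [this, map_add]
  rfl

variable [ContinuousSMul ℝ E]

theorem eq_of_forall_functional [LocallyConvexSpace ℝ E] [T2Space E] {x y : E}
    (h : ∀ φ : E →L[ℝ] ℝ, φ x = φ y) : x = y := by
  by_contra hxy
  obtain ⟨φ, hφ⟩ := SeparatingDual.exists_separating_of_ne (R := ℝ) hxy
  exact hφ (h φ)

/-- A family of continuous affine maps has a common fixed point in a compact set `K` as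
soon as it has approximate fixed points, tested on finitely many maps and functionals. -/
theorem exists_fixed_of_approx [LocallyConvexSpace ℝ E] [T2Space E] {K : Set E}
    (hKc : IsCompact K) {ι : Type*} (A : ι → E →ᵃ[ℝ] E) (hA : ∀ i, Continuous (A i))
    (happ : ∀ (s : Finset ι) (t : Finset (E →L[ℝ] ℝ)) (ε : ℝ), 0 < ε →
      ∃ x ∈ K, ∀ i ∈ s, ∀ φ ∈ t, |φ (A i x) - φ x| ≤ ε) :
    ∃ x ∈ K, ∀ i, A i x = x := by
  classical
  have key := hKc.inter_iInter_nonempty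
    (fun q : ι × (E →L[ℝ] ℝ) × {ε : ℝ // 0 < ε} => {x | |q.2.1 (A q.1 x) - q.2.1 x| ≤ q.2.2})
    (fun q => isClosed_le (((q.2.1.continuous.comp (hA q.1)).sub q.2.1.continuous).abs)
      continuous_const) ?_
  · obtain ⟨x, hx, hx'⟩ := key
    refine ⟨x, hx, fun i => eq_of_forall_functional fun φ => ?_⟩
    refine sub_eq_zero.1 (abs_nonpos_iff.1 (le_of_forall_pos_le_add fun ε hε => ?_))
    rw [zero_add]
    exact mem_iInter.1 hx' (i, φ, ⟨ε, hε⟩)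
  intro u
  have hε : ∃ ε : ℝ, 0 < ε ∧ ∀ q ∈ u, ε ≤ q.2.2 := by
    induction u using Finset.induction_on with
    | empty => exact ⟨1, one_pos, by simp⟩
    | insert a u _ ih =>
      obtain ⟨ε, h0, h⟩ := ih
      refine ⟨min a.2.2 ε, lt_min a.2.2.2 h0, fun q hq => ?_⟩
      rcases Finset.mem_insert.1 hq with rfl | hq
      · exact min_le_left _ _
      · exact (min_le_right _ _).trans (h q hq)
  obtain ⟨ε, h0, h⟩ := hε
  obtain ⟨x, hx, hxu⟩ := happ (u.image fun q => q.1) (u.image fun q => q.2.1) ε h0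
  refine ⟨x, hx, mem_iInter₂.2 fun q hq => ?_⟩
  exact (hxu _ (Finset.mem_image_of_mem _ hq) _ (Finset.mem_image_of_mem (fun q => q.2.1) hq)).trans
    (h q hq)

end Barycenter

/-! ### Chabauty limits of amenable subgroups are relatively amenable -/

section ChabautyLimit

theorem IsConvexCompactGSpace.restrict {G : Type*} [Group G] [TopologicalSpace G] {E : Type*}
    [AddCommGroup E] [Module ℝ E] [TopologicalSpace E] {ρ : G →* (E →ᵃ[ℝ] E)} {K : Set E}
    (h : IsConvexCompactGSpace ρ K) (L : Subgroup G) :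
    IsConvexCompactGSpace (ρ.comp L.subtype) K where
  convex := h.convex
  isCompact := h.isCompact
  continuous_apply g := h.continuous_apply g
  mapsTo g := h.mapsTo g
  continuousOn := by
    have : Continuous fun p : L × E => ((p.1 : G), p.2) := by fun_prop
    exact h.continuousOn.comp this.continuousOn fun p hp => ⟨mem_univ _, hp.2⟩

/-- In a convex compact `G`-space, consider the sets of points fixed by some element
of an open set `U` meeting `H`. The approximating amenable subgroups show that these have the finite
intersection property, and a point in all their closures is fixed by `H`. -/
theorem isRelativelyAmenable_of_mem_closure {G : Type u} [Group G] [TopologicalSpace G]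
    {H : ClosedSubgroup G}
    (hH : H ∈ closure {L : ClosedSubgroup G | IsAmenableGroup L.toSubgroup}) :
    IsRelativelyAmenable H.toSubgroup := by
  intro E _ _ _ _ _ _ _ ρ K hK hKn
  let ι := {U : Set G // IsOpen U ∧ ((H : Set G) ∩ U).Nonempty}
  let A : ι → Set E := fun U => {x ∈ K | ∃ g ∈ U.1, ρ g x = x}
  obtain ⟨x, hx, hxA⟩ := hK.isCompact.inter_iInter_nonempty (fun U : ι => closure (A U))
    (fun _ => isClosed_closure) fun s => by
      have hopen : IsOpen (⋂ U ∈ s, {L : ClosedSubgroup G | ((L : Set G) ∩ U.1).Nonempty}) :=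
        isOpen_biInter_finset fun U _ =>
          TopologicalSpace.isOpen_generateFrom_of_mem (Or.inr ⟨U.1, U.2.1, rfl⟩)
      obtain ⟨L, hL, hLam⟩ := mem_closure_iff.1 hH _ hopen (mem_iInter₂.2 fun U _ => U.2.2)
      obtain ⟨x, hx, hfix⟩ := hLam E _ K (hK.restrict L.toSubgroup) hKn
      refine ⟨x, hx, mem_iInter₂.2 fun U hU => subset_closure ⟨hx, ?_⟩⟩
      obtain ⟨g, hgL, hgU⟩ := mem_iInter₂.1 hL U hU
      exact ⟨g, hgU, hfix ⟨g, hgL⟩⟩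
  refine ⟨x, hx, fun h hh => ?_⟩
  by_contra hne
  have hcont : ContinuousWithinAt (fun p : G × E => (ρ p.1 p.2, p.2)) (univ ×ˢ K) (h, x) :=
    (hK.continuousOn (h, x) ⟨mem_univ _, hx⟩).prodMk continuous_snd.continuousWithinAt
  have hev : ∀ᶠ p in 𝓝[univ ×ˢ K] (h, x), ρ p.1 p.2 ≠ p.2 :=
    hcont.eventually ((isClosed_eq continuous_fst continuous_snd).isOpen_compl.mem_nhds hne)
  rw [nhdsWithin_prod_eq, nhdsWithin_univ] at hev
  obtain ⟨P, hP, Q, hQ, hPQ⟩ := Filter.eventually_prod_iff.1 hev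
  obtain ⟨U, hUP, hUo, hhU⟩ := mem_nhds_iff.1 hP
  have hxU : x ∈ closure (A ⟨U, hUo, ⟨h, hh, hhU⟩⟩) := mem_iInter.1 hxA ⟨U, hUo, ⟨h, hh, hhU⟩⟩
  obtain ⟨V, hV, hVQ⟩ := mem_nhdsWithin_iff_exists_mem_nhds_inter.1 hQ
  obtain ⟨y, hyV, hyK, g, hgU, hgy⟩ := mem_closure_iff_nhds.1 hxU V hV
  exact hPQ (hUP hgU) (hVQ ⟨hyV, hyK⟩) hgy

end ChabautyLimit

/-! ### Derighetti's condition for open and for normal subgroups -/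

section OpenNormal

variable {G : Type*} [Group G] [TopologicalSpace G]

/-- A regular `G`-invariant measure on `G ⧸ H` for which some set of measure one is `H`-invariant
witnesses Derighetti's condition: the indicator function of the set is fixed by `H`. -/
theorem derighettiCondition_of_invariant (H : Subgroup G) [mX : MeasurableSpace (G ⧸ H)]
    [BorelSpace (G ⧸ H)] (μ : Measure (G ⧸ H)) [μ.Regular]
    (hinv : ∀ (g : G) (f : G ⧸ H → ℝ), Continuous f → HasCompactSupport f →
      ∫ x, f (g⁻¹ • x) ∂μ = ∫ x, f x ∂μ)
    (S : Set (G ⧸ H)) (hS : MeasurableSet S) (hμS : μ S = 1)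
    (hHS : ∀ h ∈ H, ∀ x : G ⧸ H, h⁻¹ • x ∈ S ↔ x ∈ S) : DerighettiCondition H := by
  obtain rfl : mX = borel (G ⧸ H) := BorelSpace.measurable_eq
  let : MeasurableSpace (G ⧸ H) := borel (G ⧸ H)
  refine ⟨μ, fun _ _ => 1, ⟨inferInstance, ?_, continuous_const, fun _ _ => one_pos, ?_⟩, ?_⟩
  · intro h0
    simp [h0] at hμS
  · intro g f hf hfc
    simpa using hinv g f hf hfc
  · intro Q hQ _ ε _
    refine ⟨S.indicator fun _ => 1, memLp_indicator_const 2 hS 1 (Or.inr (by simp [hμS])), ?_, ?_⟩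
    · rw [eLpNorm_indicator_const hS (by simp) (by simp), hμS]
      simp
    · intro h hh
      have : quasiRegular (fun _ _ => 1) h (S.indicator fun _ => (1 : ℝ)) =
          S.indicator fun _ => (1 : ℝ) := by
        funext x
        by_cases hx : x ∈ S
        · simp [quasiRegular, hx, hHS h (hQ hh) x]
        · simp [quasiRegular, hx, hHS h (hQ hh) x]
      rw [this, sub_self, eLpNorm_zero]
      exact zero_le

theorem regular_count {X : Type*} [TopologicalSpace X] [DiscreteTopology X] [MeasurableSpace X]
    [BorelSpace X] : (Measure.count : Measure X).Regular where
  lt_top_of_isCompact := fun K hK => by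
    rw [Measure.count_apply_lt_top]
    exact hK.finite_of_discrete
  outerRegular := fun A _ r hr => ⟨A, Subset.rfl, isOpen_discrete A, hr⟩
  innerRegular := fun U _ r hr => by
    rcases U.finite_or_infinite with hU | hU
    · exact ⟨U, Subset.rfl, hU.isCompact, hr⟩
    · obtain ⟨n, hn⟩ := ENNReal.exists_nat_gt hr.ne_top
      obtain ⟨t, htU, htn⟩ := hU.exists_subset_card_eq n
      refine ⟨t, htU, t.finite_toSet.isCompact, hn.trans_le ?_⟩
      rw [Measure.count_apply (isOpen_discrete _).measurableSet, Set.encard_coe_eq_coe_finsetCard,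
        htn]
      simp

variable [IsTopologicalGroup G]

theorem derighettiCondition_of_isOpen (H : Subgroup G) (hH : IsOpen (H : Set G)) :
    DerighettiCondition H := by
  borelize (G ⧸ H)
  have : DiscreteTopology (G ⧸ H) := QuotientGroup.discreteTopology hH
  have := regular_count (X := G ⧸ H)
  refine derighettiCondition_of_invariant H Measure.count (fun g f _ _ => ?_) {((1 : G) : G ⧸ H)}
    (isOpen_discrete _).measurableSet (Measure.count_singleton _) fun h hh x => ?_
  · have hpres : MeasurePreserving (fun x : G ⧸ H => g⁻¹ • x) Measure.count Measure.count := by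
      refine ⟨continuous_of_discreteTopology.measurable, Measure.ext fun s hs => ?_⟩
      rw [Measure.map_apply continuous_of_discreteTopology.measurable hs,
        Measure.count_apply (isOpen_discrete _).measurableSet, Measure.count_apply hs,
        Set.preimage_smul, inv_inv, Set.encard_smul_set]
    exact hpres.integral_comp (Homeomorph.smul g⁻¹).measurableEmbedding f
  · rw [mem_singleton_iff, mem_singleton_iff, inv_smul_eq_iff]
    have : h • ((1 : G) : G ⧸ H) = ((1 : G) : G ⧸ H) := by
      rw [← MulAction.mem_stabilizer_iff, MulAction.stabilizer_quotient]
      exact hh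
    rw [this]

theorem derighettiCondition_of_normal [LocallyCompactSpace G] (H : Subgroup G)
    (hc : IsClosed (H : Set G)) (hH : H.Normal) : DerighettiCondition H := by
  borelize (G ⧸ H)
  have := hH
  have := hc
  obtain ⟨K⟩ : Nonempty (TopologicalSpace.PositiveCompacts (G ⧸ H)) := inferInstance
  have hsmul : ∀ (g : G) (x : G ⧸ H), g • x = (g : G ⧸ H) * x := fun g x => by
    induction x using QuotientGroup.induction_on with
    | H y => rfl
  refine derighettiCondition_of_invariant H (Measure.haarMeasure K) (fun g f _ _ => ?_) K
    K.isCompact.isClosed.measurableSet Measure.haarMeasure_self fun h hh x => ?_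
  · simp only [hsmul]
    exact integral_mul_left_eq_self f _
  · rw [hsmul, (QuotientGroup.eq_one_iff h⁻¹).2 (H.inv_mem hh), one_mul]

end OpenNormal

/-! ### Almost invariant densities from almost invariant vectors -/

section Density

open scoped ENNReal

/-- Compactly supported continuous functions are dense in `L^p` for a regular measure on a locally
compact Hausdorff space, which need not be normal. -/
theorem exists_continuous_hasCompactSupport_eLpNorm_sub_le {X : Type*} [TopologicalSpace X]
    [T2Space X] [LocallyCompactSpace X] [MeasurableSpace X] [BorelSpace X] {μ : Measure X}
    [μ.Regular] {p : ℝ≥0∞} (hp : p ≠ ∞) {f : X → ℝ} (hf : MemLp f p μ) {ε : ℝ≥0∞} (hε : ε ≠ 0) :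
    ∃ g : X → ℝ, eLpNorm (f - g) p μ ≤ ε ∧ Continuous g ∧ HasCompactSupport g := by
  refine hf.induction_dense hp _ ?_ ?_ ?_ hε
  · intro c t ht htμ ε hε
    obtain ⟨η, ηpos, hη⟩ := exists_eLpNorm_indicator_le (μ := μ) hp c hε
    have hη0 : (η / 2 : ℝ≥0∞) ≠ 0 := by simpa using ηpos.ne'
    obtain ⟨s, st, s_compact, s_closed, μs⟩ := ht.exists_isCompact_isClosed_sdiff_lt htμ.ne hη0
    obtain ⟨V, sV, V_open, -, hV⟩ := s_closed.measurableSet.exists_isOpen_sdiff_lt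
      ((measure_mono st).trans_lt htμ).ne hη0
    obtain ⟨g, hgs, hgV, hgc, hg01⟩ := exists_continuous_one_zero_of_isCompact s_compact
      V_open.isClosed_compl (disjoint_compl_right_iff_subset.2 sV)
    refine ⟨fun x => g x * c, ?_, g.continuous.mul continuous_const, hgc.mul_right⟩
    -- the difference is bounded by `c` and lives on the small set `(t \ s) ∪ (V \ s)`
    refine (eLpNorm_mono fun x => ?_).trans (hη ((t \ s) ∪ (V \ s))
      ((measure_union_le _ _).trans ((add_le_add μs.le hV.le).trans (by simp))))
    simp only [Pi.sub_apply, Real.norm_eq_abs]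
    have h0 := (hg01 x).1
    have h1 := (hg01 x).2
    by_cases hxs : x ∈ s
    · have : g x = 1 := hgs hxs
      simp [this, st hxs]
    by_cases hxt : x ∈ t
    · rw [indicator_of_mem hxt,
        indicator_of_mem (show x ∈ (t \ s) ∪ (V \ s) from Or.inl ⟨hxt, hxs⟩)]
      rw [show g x * c - c = (g x - 1) * c by ring, abs_mul]
      exact mul_le_of_le_one_left (abs_nonneg _) (abs_le.2 ⟨by linarith, by linarith⟩)
    by_cases hxV : x ∈ V
    · rw [indicator_of_notMem hxt,
        indicator_of_mem (show x ∈ (t \ s) ∪ (V \ s) from Or.inr ⟨hxV, hxs⟩), sub_zero, abs_mul]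
      exact mul_le_of_le_one_left (abs_nonneg _) (abs_le.2 ⟨by linarith, by linarith⟩)
    · have : g x = 0 := hgV hxV
      simp [this, hxt]
  · rintro f g ⟨hf, hfc⟩ ⟨hg, hgc⟩
    exact ⟨hf.add hg, hfc.add hgc⟩
  · rintro f ⟨hf, hfc⟩
    exact (hf.integrable_of_hasCompactSupport hfc).aestronglyMeasurable

theorem eLpNorm_two_eq_ofReal_sqrt {X : Type*} [TopologicalSpace X] [MeasurableSpace X]
    [BorelSpace X] {μ : Measure X} {f : X → ℝ} [IsFiniteMeasureOnCompacts μ] (hf : Continuous f)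
    (hfc : HasCompactSupport f) : eLpNorm f 2 μ = ENNReal.ofReal √(∫ x, f x ^ 2 ∂μ) := by
  have hf2 : MemLp f 2 μ := hf.memLp_of_hasCompactSupport hfc
  rw [hf2.eLpNorm_eq_integral_rpow_norm (by simp) (by simp)]
  simp [Real.sqrt_eq_rpow]

variable {G X : Type*} [Group G] [TopologicalSpace G] [TopologicalSpace X]
  [MulAction G X] [MeasurableSpace X] [BorelSpace X] {μ : Measure X} {lam : G → X → ℝ}

theorem IsQuasiInvariant.continuous_right (hq : IsQuasiInvariant μ lam) (g : G) :
    Continuous (lam g) :=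
  hq.continuous.comp (Continuous.prodMk_right g)

variable [T2Space X] [LocallyCompactSpace X] [ContinuousConstSMul G X]

theorem IsQuasiInvariant.setLIntegral_le_of_isCompact (hq : IsQuasiInvariant μ lam) (g : G)
    {C U : Set X} (hC : IsCompact C) (hU : IsOpen U) (hCU : C ⊆ U) :
    ∫⁻ x in C, ENNReal.ofReal (lam g x) ∂μ ≤ μ {x | g⁻¹ • x ∈ U} := by
  have := hq.regular
  obtain ⟨f, hfC, hfU, hfc, hf01⟩ := exists_continuous_one_zero_of_isCompact hC
      hU.isClosed_compl (disjoint_compl_right_iff_subset.2 hCU)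
  have hfg : HasCompactSupport fun x => f (g⁻¹ • x) := hfc.comp_homeomorph (Homeomorph.smul g⁻¹)
  have hfgc : Continuous fun x => f (g⁻¹ • x) := f.continuous.comp (continuous_const_smul g⁻¹)
  have hfl : Integrable (fun x => f x * lam g x) μ :=
    integrable_mul_of_hasCompactSupport f.continuous hfc (hq.continuous_right g)
  calc ∫⁻ x in C, ENNReal.ofReal (lam g x) ∂μ
      = ∫⁻ x, C.indicator (fun x => ENNReal.ofReal (lam g x)) x ∂μ :=
        (lintegral_indicator hC.measurableSet _).symm
    _ ≤ ∫⁻ x, ENNReal.ofReal (f x * lam g x) ∂μ := by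
        refine lintegral_mono fun x => ?_
        by_cases hx : x ∈ C
        · have : f x = 1 := hfC hx
          simp [hx, this]
        · simp [hx]
    _ = ENNReal.ofReal (∫ x, f (g⁻¹ • x) ∂μ) := by
        rw [hq.integral_smul g f f.continuous hfc, ofReal_integral_eq_lintegral_ofReal hfl]
        exact Filter.Eventually.of_forall fun x => mul_nonneg (hf01 x).1 (hq.pos g x).le
    _ = ∫⁻ x, ENNReal.ofReal (f (g⁻¹ • x)) ∂μ := by
        rw [ofReal_integral_eq_lintegral_ofReal (hfgc.integrable_of_hasCompactSupport hfg)]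
        exact Filter.Eventually.of_forall fun x => (hf01 _).1
    _ ≤ ∫⁻ x, {x | g⁻¹ • x ∈ U}.indicator 1 x ∂μ := by
        refine lintegral_mono fun x => ?_
        by_cases hx : g⁻¹ • x ∈ U
        · simpa [hx] using (hf01 (g⁻¹ • x)).2
        · have : f (g⁻¹ • x) = 0 := hfU hx
          simp [hx, this]
    _ = μ {x | g⁻¹ • x ∈ U} :=
        lintegral_indicator_one (hU.preimage (continuous_const_smul g⁻¹)).measurableSet

/-- One half of the change of variables formula, for arbitrary sets: it follows from the formula for
compactly supported continuous functions by regularity. On an open set of finite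
translated measure, one exhausts by the open sets on which `lam g` is bounded above and below; these
have finite measure and so are approximated by compact sets. -/
theorem IsQuasiInvariant.withDensity_le_map (hq : IsQuasiInvariant μ lam) (g : G) :
    μ.withDensity (fun x => ENNReal.ofReal (lam g x)) ≤ μ.map (fun x => g⁻¹ • x) := by
  have := hq.regular
  have hmeas : Measurable fun x : X => g⁻¹ • x := (continuous_const_smul g⁻¹).measurable
  have hmap : (μ.map fun x : X => g⁻¹ • x).Regular := Measure.Regular.map (Homeomorph.smul g⁻¹)
  have hopen : ∀ U : Set X, IsOpen U → μ.withDensity (fun x => ENNReal.ofReal (lam g x)) U ≤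
      μ.map (fun x => g⁻¹ • x) U := by
    intro U hU
    rw [Measure.map_apply hmeas hU.measurableSet]
    set M := μ ((fun x => g⁻¹ • x) ⁻¹' U) with hM
    rcases eq_or_ne M ∞ with hMt | hMt
    · rw [hMt]; exact le_top
    let V : ℕ → Set X := fun n => U ∩ {x | ((n : ℝ) + 1)⁻¹ < lam g x ∧ lam g x < (n : ℝ) + 1}
    have hVo : ∀ n, IsOpen (V n) := fun n => hU.inter
      ((isOpen_lt continuous_const (hq.continuous_right g)).inter
        (isOpen_lt (hq.continuous_right g) continuous_const))
    have hVmono : Monotone V := by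
      intro m n hmn x hx
      have hmn' : (m : ℝ) ≤ n := Nat.cast_le.2 hmn
      refine ⟨hx.1, lt_of_le_of_lt ?_ hx.2.1, hx.2.2.trans_le (by linarith)⟩
      exact inv_anti₀ (by positivity) (by linarith)
    have hVU : ⋃ n, V n = U := by
      refine subset_antisymm (iUnion_subset fun n => inter_subset_left) fun x hx => ?_
      have h0 := hq.pos g x
      obtain ⟨n, hn⟩ := exists_nat_gt (max (lam g x) (lam g x)⁻¹)
      have h1 := (le_max_left _ _).trans_lt hn
      have h2 := (le_max_right _ _).trans_lt hn
      refine mem_iUnion.2 ⟨n, hx, ?_, by linarith⟩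
      exact inv_lt_of_inv_lt₀ h0 (by linarith)
    rw [← hVU, hVmono.measure_iUnion]
    refine iSup_le fun n => ?_
    have hVm := (hVo n).measurableSet
    have hc : ∀ C ⊆ V n, IsCompact C → ∫⁻ x in C, ENNReal.ofReal (lam g x) ∂μ ≤ M :=
      fun C hCV hC => hq.setLIntegral_le_of_isCompact g hC hU (hCV.trans inter_subset_left)
    have hfin : μ (V n) ≠ ∞ := by
      refine ne_top_of_le_ne_top (b := ENNReal.ofReal (n + 1) * M)
        (ENNReal.mul_ne_top ENNReal.ofReal_ne_top hMt) ?_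
      rw [(hVo n).measure_eq_iSup_isCompact]
      refine iSup₂_le fun C hCV => iSup_le fun hC => ?_
      calc μ C = ∫⁻ _ in C, 1 ∂μ := by simp
        _ ≤ ∫⁻ x in C, ENNReal.ofReal (n + 1) * ENNReal.ofReal (lam g x) ∂μ := by
            refine setLIntegral_mono' hC.measurableSet fun x hx => ?_
            rw [← ENNReal.ofReal_mul (by positivity), ← ENNReal.ofReal_one]
            refine ENNReal.ofReal_le_ofReal ?_
            have := (hCV hx).2.1.le
            rwa [inv_le_iff_one_le_mul₀' (by positivity)] at this
        _ = ENNReal.ofReal (n + 1) * ∫⁻ x in C, ENNReal.ofReal (lam g x) ∂μ :=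
            lintegral_const_mul' _ _ ENNReal.ofReal_ne_top
        _ ≤ _ := mul_le_mul_right (hc C hCV hC) _
    refine ENNReal.le_of_forall_pos_le_add fun ε hε _ => ?_
    have hn0 : ENNReal.ofReal (n + 1) ≠ 0 := by
      rw [Ne, ENNReal.ofReal_eq_zero, not_le]; positivity
    obtain ⟨C, hCV, hC, hCε⟩ := hVm.exists_isCompact_sdiff_lt hfin
      (ENNReal.div_pos (ENNReal.coe_pos.2 hε).ne' (ENNReal.ofReal_ne_top (r := n + 1))).ne'
    rw [withDensity_apply _ hVm]
    calc ∫⁻ x in V n, ENNReal.ofReal (lam g x) ∂μ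
        ≤ ∫⁻ x in C ∪ V n \ C, ENNReal.ofReal (lam g x) ∂μ :=
          lintegral_mono_set (by rw [union_sdiff_self]; exact subset_union_right)
      _ ≤ ∫⁻ x in C, ENNReal.ofReal (lam g x) ∂μ + ∫⁻ x in V n \ C, ENNReal.ofReal (lam g x) ∂μ :=
          lintegral_union_le _ _ _
      _ ≤ M + ∫⁻ _ in V n \ C, ENNReal.ofReal (n + 1) ∂μ := by
          refine add_le_add (hc C hCV hC) (setLIntegral_mono' (hVm.diff hC.measurableSet) ?_)
          exact fun x hx => ENNReal.ofReal_le_ofReal hx.1.2.2.le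
      _ ≤ M + ε := by
          rw [setLIntegral_const]
          refine add_le_add le_rfl ((mul_le_mul_right hCε.le _).trans ?_)
          rw [ENNReal.mul_div_cancel hn0 ENNReal.ofReal_ne_top]
  refine Measure.le_iff.2 fun A _ => ?_
  rw [A.measure_eq_iInf_isOpen (μ.map fun x => g⁻¹ • x)]
  exact le_iInf₂ fun U hAU => le_iInf fun hU => (measure_mono hAU).trans (hopen U hU)

theorem IsQuasiInvariant.quasiMeasurePreserving_smul (hq : IsQuasiInvariant μ lam) (g : G) :
    Measure.QuasiMeasurePreserving (fun x : X => g • x) μ μ := by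
  have hmeas : ∀ g : G, Measurable fun x : X => g • x := fun g =>
    (continuous_const_smul g).measurable
  refine ⟨hmeas g, Measure.AbsolutelyContinuous.mk fun s hs h0 => ?_⟩
  rw [Measure.map_apply (hmeas g) hs]
  have hpre : MeasurableSet ((fun x : X => g • x) ⁻¹' s) := hmeas g hs
  have h1 := Measure.le_iff.1 (hq.withDensity_le_map g) _ hpre
  rw [Measure.map_apply (hmeas g⁻¹) hpre, ← preimage_comp, withDensity_apply _ hpre] at h1
  have h2 : (fun x : X => g • x) ∘ (fun x => g⁻¹ • x) = id := by
    funext x; simp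
  rw [h2, preimage_id, h0, nonpos_iff_eq_zero,
    setLIntegral_eq_zero_iff hpre (hq.continuous_right g).measurable.ennreal_ofReal] at h1
  rw [← compl_compl ((fun x : X => g • x) ⁻¹' s), ← mem_ae_iff]
  filter_upwards [h1] with x hx hxs
  exact absurd (ENNReal.ofReal_eq_zero.1 (hx hxs)) (not_le.2 (hq.pos g x))

/-- The quasi-regular representation does not increase `L²`-norms. -/
theorem IsQuasiInvariant.eLpNorm_quasiRegular_le (hq : IsQuasiInvariant μ lam) (g : G) (f : X → ℝ) :
    eLpNorm (quasiRegular lam g f) 2 μ ≤ eLpNorm f 2 μ := by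
  rw [eLpNorm_eq_lintegral_rpow_enorm_toReal (by simp) (by simp),
    eLpNorm_eq_lintegral_rpow_enorm_toReal (by simp) (by simp)]
  refine ENNReal.rpow_le_rpow ?_ (by simp)
  simp only [ENNReal.toReal_ofNat, ENNReal.rpow_ofNat]
  have hmeas : Measurable fun x => ENNReal.ofReal (lam g⁻¹ x) :=
    (hq.continuous_right g⁻¹).measurable.ennreal_ofReal
  calc ∫⁻ x, ‖quasiRegular lam g f x‖ₑ ^ 2 ∂μ
      = ∫⁻ x, ((fun x => ENNReal.ofReal (lam g⁻¹ x)) * fun x => ‖f (g⁻¹ • x)‖ₑ ^ 2) x ∂μ := by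
        refine lintegral_congr fun x => ?_
        rw [quasiRegular, enorm_mul, mul_pow, Pi.mul_apply,
          Real.enorm_of_nonneg (Real.sqrt_nonneg _), ← ENNReal.ofReal_pow (Real.sqrt_nonneg _),
            Real.sq_sqrt (hq.pos _ _).le]
    _ = ∫⁻ x, ‖f (g⁻¹ • x)‖ₑ ^ 2 ∂(μ.withDensity fun x => ENNReal.ofReal (lam g⁻¹ x)) :=
        (lintegral_withDensity_eq_lintegral_mul_non_measurable _ hmeas
          (Filter.Eventually.of_forall fun _ => ENNReal.ofReal_lt_top) _).symm
    _ ≤ ∫⁻ x, ‖f (g⁻¹ • x)‖ₑ ^ 2 ∂(μ.map fun x => g⁻¹⁻¹ • x) :=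
        lintegral_mono' (hq.withDensity_le_map g⁻¹) le_rfl
    _ = ∫⁻ x, ‖f (g⁻¹ • g⁻¹⁻¹ • x)‖ₑ ^ 2 ∂μ :=
        (Homeomorph.smul g⁻¹⁻¹).measurableEmbedding.lintegral_map _
    _ = ∫⁻ x, ‖f x‖ₑ ^ 2 ∂μ := by simp

/-- If `f` is an almost invariant unit vector in `L²`, then (a normalised continuous approximation
of) `f²` is an almost invariant probability density. -/
theorem IsQuasiInvariant.exists_almost_invariant_density (hq : IsQuasiInvariant μ lam) (S : Set G)
    (hS : ∀ δ : ℝ, 0 < δ → ∃ f : X → ℝ, MemLp f 2 μ ∧ eLpNorm f 2 μ = 1 ∧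
      ∀ h ∈ S, eLpNorm (quasiRegular lam h f - f) 2 μ ≤ ENNReal.ofReal δ)
    {ε : ℝ} (hε : 0 < ε) :
    ∃ p : X → ℝ, Continuous p ∧ HasCompactSupport p ∧ (∀ x, 0 ≤ p x) ∧ ∫ x, p x ∂μ = 1 ∧
      ∀ h ∈ S, ∫ x, |p (h⁻¹ • x) * lam h⁻¹ x - p x| ∂μ ≤ ε := by
  have := hq.regular
  obtain ⟨δ, hδ0, hδ1, hδε⟩ : ∃ δ : ℝ, 0 < δ ∧ δ ≤ 1 / 4 ∧ 11 * δ ≤ ε :=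
    ⟨min (1 / 4) (ε / 11), lt_min (by norm_num) (by positivity), min_le_left _ _, by
      have := min_le_right (1 / 4) (ε / 11); linarith⟩
  obtain ⟨f, hf, hf1, hfS⟩ := hS δ hδ0
  obtain ⟨k, hfk, hk, hkc⟩ := exists_continuous_hasCompactSupport_eLpNorm_sub_le (by simp) hf
    (ENNReal.ofReal_pos.2 hδ0).ne'
  have hkm : AEStronglyMeasurable k μ := 
    (hk.integrable_of_hasCompactSupport hkc).aestronglyMeasurable
  set N := ∫ x, k x ^ 2 ∂μ with hN
  have hkN := eLpNorm_two_eq_ofReal_sqrt (μ := μ) hk hkc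
  have hsqN : 3 / 4 ≤ √N := by
    have h1 : (1 : ℝ≥0∞) ≤ ENNReal.ofReal (δ + √N) := by
      rw [← hf1, ENNReal.ofReal_add hδ0.le (Real.sqrt_nonneg _), ← hkN]
      calc eLpNorm f 2 μ = eLpNorm ((f - k) + k) 2 μ := by rw [sub_add_cancel]
        _ ≤ eLpNorm (f - k) 2 μ + eLpNorm k 2 μ :=
          eLpNorm_add_le (hf.aestronglyMeasurable.sub hkm) hkm (by simp)
        _ ≤ _ := add_le_add hfk le_rfl
    rw [ENNReal.one_le_ofReal] at h1
    linarith
  have hN2 : 1 / 2 ≤ N := by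
    have h0 : 0 ≤ N := integral_nonneg fun x => sq_nonneg _
    have := Real.sq_sqrt h0
    nlinarith
  have hk2c : HasCompactSupport fun x => k x ^ 2 := by
    simp only [sq]
    exact hkc.mul_right
  refine ⟨fun x => k x ^ 2 / N, (hk.pow 2).div_const N, ?_, fun x => by positivity, ?_, ?_⟩
  · simp only [div_eq_mul_inv]
    exact hk2c.mul_right
  · rw [integral_div, ← hN, div_self (by linarith)]
  intro h hh
  set w : X → ℝ := quasiRegular lam h k with hw
  have hsm : Continuous fun x : X => h⁻¹ • x := continuous_const_smul h⁻¹
  have hwcont : Continuous w := (hq.continuous_right h⁻¹).sqrt.mul (hk.comp hsm)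
  have hwc : HasCompactSupport w := (hkc.comp_homeomorph (Homeomorph.smul h⁻¹)).mul_left
  have hw2 : ∀ x, w x ^ 2 = k (h⁻¹ • x) ^ 2 * lam h⁻¹ x := fun x => by
    rw [hw, quasiRegular, mul_pow, Real.sq_sqrt (hq.pos _ _).le, mul_comm]
  have hwN : ∫ x, w x ^ 2 ∂μ = N := by
    have := hq.integral_smul h⁻¹ (fun x => k (h⁻¹ • x) ^ 2) ((hk.comp hsm).pow 2)
      (hk2c.comp_homeomorph (Homeomorph.smul h⁻¹))
    simp only [hw2, ← this, smul_smul, mul_inv_cancel, one_smul, hN]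
  have hdiff : ∫ x, (w x - k x) ^ 2 ∂μ ≤ 9 * δ ^ 2 := by
    have h1 : eLpNorm (w - k) 2 μ ≤ ENNReal.ofReal (3 * δ) := by
      have hmeas : ∀ v : X → ℝ, AEStronglyMeasurable v μ →
          AEStronglyMeasurable (quasiRegular lam h v) μ := fun v hv =>
        (hq.continuous_right h⁻¹).sqrt.measurable.aestronglyMeasurable.mul
          (hv.comp_quasiMeasurePreserving (hq.quasiMeasurePreserving_smul h⁻¹))
      have hfm := hf.aestronglyMeasurable
      have hsub : w - k = quasiRegular lam h (k - f) + ((quasiRegular lam h f - f) + (f - k)) := by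
        funext x
        simp only [hw, quasiRegular, Pi.sub_apply, Pi.add_apply]
        ring
      have hkf : eLpNorm (quasiRegular lam h (k - f)) 2 μ ≤ ENNReal.ofReal δ := by
        refine (hq.eLpNorm_quasiRegular_le h _).trans ?_
        rwa [eLpNorm_sub_comm]
      rw [hsub, show 3 * δ = δ + (δ + δ) by ring, ENNReal.ofReal_add hδ0.le (by linarith),
        ENNReal.ofReal_add hδ0.le hδ0.le]
      refine (eLpNorm_add_le (hmeas _ (hkm.sub hfm))
        (((hmeas _ hfm).sub hfm).add (hfm.sub hkm)) (by simp)).trans (add_le_add hkf ?_)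
      exact (eLpNorm_add_le ((hmeas _ hfm).sub hfm) (hfm.sub hkm) (by simp)).trans
        (add_le_add (hfS h hh) hfk)
    rw [eLpNorm_two_eq_ofReal_sqrt (hwcont.sub hk) (hwc.sub hkc),
      ENNReal.ofReal_le_ofReal_iff (by linarith), Real.sqrt_le_left (by linarith)] at h1
    calc _ ≤ (3 * δ) ^ 2 := h1
      _ = 9 * δ ^ 2 := by ring
  have hint : ∀ v : X → ℝ, Continuous v → HasCompactSupport v →
      Integrable (fun x => v x ^ 2) μ := fun v hv hvc => by
    simpa [sq] using integrable_mul_of_hasCompactSupport hv hvc hv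
  have hwi := hint w hwcont hwc
  have hki := hint k hk hkc
  have hdi := hint (fun x => w x - k x) (hwcont.sub hk) (hwc.sub hkc)
  have hwki : Integrable (fun x => w x ^ 2 + k x ^ 2) μ := hwi.add hki
  -- Young's inequality applied to `w ^ 2 - k ^ 2 = (w - k) * (w + k)`
  have hpt : ∀ x, |k (h⁻¹ • x) ^ 2 / N * lam h⁻¹ x - k x ^ 2 / N| ≤
      N⁻¹ * ((2 * δ)⁻¹ * (w x - k x) ^ 2 + δ * (w x ^ 2 + k x ^ 2)) := fun x => by
    have e1 : k (h⁻¹ • x) ^ 2 / N * lam h⁻¹ x - k x ^ 2 / N = N⁻¹ * (w x ^ 2 - k x ^ 2) := by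
      rw [hw2]; ring
    rw [e1, abs_mul, abs_of_pos (by positivity : 0 < N⁻¹)]
    refine mul_le_mul_of_nonneg_left ?_ (by positivity)
    have e2 : (2 * δ)⁻¹ * (w x - k x) ^ 2 * (2 * δ) = (w x - k x) ^ 2 := by
      field_simp
    rw [abs_le]
    constructor <;>
      nlinarith [sq_nonneg (w x - k x - δ * (w x + k x)), sq_nonneg (w x - k x + δ * (w x + k x)),
        sq_nonneg (w x - k x)]
  calc ∫ x, |k (h⁻¹ • x) ^ 2 / N * lam h⁻¹ x - k x ^ 2 / N| ∂μ
      ≤ ∫ x, N⁻¹ * ((2 * δ)⁻¹ * (w x - k x) ^ 2 + δ * (w x ^ 2 + k x ^ 2)) ∂μ :=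
        integral_mono_of_nonneg (Filter.Eventually.of_forall fun x => abs_nonneg _)
          (((hdi.const_mul _).add (hwki.const_mul δ)).const_mul _)
          (Filter.Eventually.of_forall hpt)
    _ = N⁻¹ * ((2 * δ)⁻¹ * ∫ x, (w x - k x) ^ 2 ∂μ + δ * (N + N)) := by
        rw [integral_const_mul, integral_add (hdi.const_mul _) (hwki.const_mul δ),
          integral_const_mul, integral_const_mul, integral_add hwi hki, hwN]
    _ ≤ N⁻¹ * ((2 * δ)⁻¹ * (9 * δ ^ 2) + δ * (N + N)) := by gcongr
    _ = N⁻¹ * (9 / 2 * δ) + 2 * δ := by field_simp; ring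
    _ ≤ 2 * (9 / 2 * δ) + 2 * δ := by
        gcongr
        exact inv_le_of_inv_le₀ (by linarith) (by linarith)
    _ ≤ ε := by linarith

end Density

/-! ### Translations of compactly supported functions -/

section Translate

open scoped CompactlySupported Pointwise

/-- Continuity of a parametric integral whose integrands have locally a common compact support. -/
theorem continuousAt_integral_of_locally_compact_support {Y X : Type*} [TopologicalSpace Y]
    [TopologicalSpace X] [MeasurableSpace X] [OpensMeasurableSpace X] {μ : Measure X}
    [IsFiniteMeasureOnCompacts μ] {F : Y → X → ℝ} (hF : Continuous (Function.uncurry F))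
    {y₀ : Y} {N : Set Y} (hN : N ∈ 𝓝 y₀) {C : Set X} (hC : IsCompact C)
    (h0 : ∀ y ∈ N, ∀ x ∉ C, F y x = 0) : ContinuousAt (fun y => ∫ x, F y x ∂μ) y₀ :=
  (continuousOn_integral_of_compact_support hC hF.continuousOn
    fun y x hy hx => h0 y hy x hx).continuousAt hN

theorem CompactlySupportedContinuousMap.integrable' {G : Type*} [TopologicalSpace G]
    [MeasurableSpace G] [OpensMeasurableSpace G] (ν : Measure G) [IsFiniteMeasureOnCompacts ν]
    (u : C_c(G, ℝ)) : Integrable u ν :=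
  u.continuous.integrable_of_hasCompactSupport u.hasCompactSupport

variable {G : Type*} [Group G] [TopologicalSpace G] [IsTopologicalGroup G]

/-- The two-sided translate `g ↦ u (a * g * b)` of a compactly supported continuous function. -/
def translateCc (a b : G) (u : C_c(G, ℝ)) : C_c(G, ℝ) where
  toFun g := u (a * g * b)
  continuous_toFun := by fun_prop
  hasCompactSupport' :=
    u.hasCompactSupport.comp_homeomorph ((Homeomorph.mulLeft a).trans (Homeomorph.mulRight b))

@[simp] theorem translateCc_apply (a b g : G) (u : C_c(G, ℝ)) :
    translateCc a b u g = u (a * g * b) := rfl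

theorem translateCc_translateCc (a b a' b' : G) (u : C_c(G, ℝ)) :
    translateCc a b (translateCc a' b' u) = translateCc (a' * a) (b * b') u := by
  ext g
  simp [mul_assoc]

theorem translateCc_nonneg (a b : G) {u : C_c(G, ℝ)} (hu : 0 ≤ u) : 0 ≤ translateCc a b u :=
  fun g => hu (a * g * b)

theorem translateCc_add (a b : G) (u v : C_c(G, ℝ)) :
    translateCc a b (u + v) = translateCc a b u + translateCc a b v := rfl

theorem translateCc_smul (a b : G) (r : ℝ) (u : C_c(G, ℝ)) :
    translateCc a b (r • u) = r • translateCc a b u := rfl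

variable [MeasurableSpace G] [BorelSpace G]

theorem integral_translateCc_right (ν : Measure G) [ν.IsMulRightInvariant] (b : G) (u : C_c(G, ℝ)) :
    ∫ g, translateCc 1 b u g ∂ν = ∫ g, u g ∂ν := by
  simpa using integral_mul_right_eq_self (μ := ν) u b

/-- Right translation is continuous in `L¹`. -/
theorem tendsto_integral_abs_translateCc_sub [LocallyCompactSpace G] (ν : Measure G)
    [IsFiniteMeasureOnCompacts ν] (u : C_c(G, ℝ)) (k₀ : G) :
    Filter.Tendsto (fun k => ∫ g, |(translateCc 1 k⁻¹ u - translateCc 1 k₀⁻¹ u) g| ∂ν)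
      (𝓝 k₀) (𝓝 0) := by
  obtain ⟨N, hN, hNk⟩ := exists_compact_mem_nhds k₀
  have hcont : Continuous (Function.uncurry fun k g : G => |u (g * k⁻¹) - u (g * k₀⁻¹)|) := by
    unfold Function.uncurry
    fun_prop
  have h := continuousAt_integral_of_locally_compact_support (μ := ν) hcont hNk
    (u.hasCompactSupport.isCompact.mul hN) fun k hk g hg => ?_
  · simpa [ContinuousAt] using h
  have hk' : ∀ k ∈ N, u (g * k⁻¹) = 0 := fun k hk => by
    by_contra hne
    exact hg ⟨g * k⁻¹, subset_tsupport _ hne, k, hk, by simp⟩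
  rw [hk' k hk, hk' k₀ (mem_of_mem_nhds hNk), sub_zero, abs_zero]

/-- A right Haar measure together with the character by which left translations scale it. -/
theorem exists_right_haar (G : Type*) [Group G] [TopologicalSpace G] [IsTopologicalGroup G]
    [LocallyCompactSpace G] [MeasurableSpace G] [BorelSpace G] :
    ∃ (ν : Measure G) (c : G → ℝ), ν.Regular ∧ ν.IsMulRightInvariant ∧ ν.IsOpenPosMeasure ∧
      (∀ h, 0 < c h) ∧
      ∀ (h : G) (u : C_c(G, ℝ)), ∫ g, u (h⁻¹ * g) ∂ν = c h * ∫ g, u g ∂ν := by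
  refine ⟨(Measure.haar : Measure G).inv,
    fun h => Measure.haarScalarFactor (Measure.map (· * h) Measure.haar) Measure.haar,
    inferInstance, inferInstance, inferInstance, fun h => ?_, fun h u => ?_⟩
  · exact NNReal.coe_pos.2 (Measure.haarScalarFactor_pos_of_isHaarMeasure _ _)
  · have hinv : ∀ f : G → ℝ, ∫ g, f g ∂(Measure.haar : Measure G).inv =
        ∫ g, f g⁻¹ ∂(Measure.haar : Measure G) := fun f =>
      (Homeomorph.inv G).measurableEmbedding.integral_map f
    have hcont : Continuous fun g : G => u g⁻¹ := by fun_prop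
    have hcs : HasCompactSupport fun g : G => u g⁻¹ :=
      u.hasCompactSupport.comp_homeomorph (Homeomorph.inv G)
    have key := Measure.integral_isMulLeftInvariant_eq_smul_of_hasCompactSupport
      (Measure.map (· * h) (Measure.haar : Measure G)) Measure.haar hcont hcs
    have hmap : ∀ f : G → ℝ, ∫ g, f g ∂(Measure.map (· * h) (Measure.haar : Measure G)) =
        ∫ g, f (g * h) ∂(Measure.haar : Measure G) := fun f =>
      (Homeomorph.mulRight h).measurableEmbedding.integral_map f
    rw [integral_smul_nnreal_measure, hmap] at key
    rw [hinv, hinv]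
    simpa [NNReal.smul_def] using key

end Translate

/-! ### Induced convex compact spaces -/

section Induced

open scoped CompactlySupported Pointwise

/-- A compact set is absorbed by every neighbourhood of zero, uniformly for small scalars. -/
theorem exists_forall_smul_mem_of_isCompact {E : Type*} [AddCommGroup E] [Module ℝ E]
    [TopologicalSpace E] [ContinuousSMul ℝ E] {K : Set E} (hK : IsCompact K) {U : Set E}
    (hU : U ∈ 𝓝 (0 : E)) : ∃ δ : ℝ, 0 < δ ∧ ∀ a : ℝ, |a| < δ → ∀ x ∈ K, a • x ∈ U := by
  have h : ∀ᶠ a : ℝ in 𝓝 0, ∀ x ∈ K, a • x ∈ U := by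
    refine hK.eventually_forall_of_forall_eventually fun x _ => ?_
    have : ContinuousAt (fun p : ℝ × E => p.1 • p.2) (0, x) := continuous_smul.continuousAt
    exact this.preimage_mem_nhds (by simpa using hU)
  obtain ⟨δ, hδ, hδ'⟩ := Metric.eventually_nhds_iff.1 h
  exact ⟨δ, hδ, fun a ha x hx => hδ' (by simpa using ha) x hx⟩

theorem CompactlySupportedContinuousMap.eq_sup_sub_sup {G : Type*} [TopologicalSpace G]
    (u : C_c(G, ℝ)) : u = (u ⊔ 0) - (-u ⊔ 0) := by
  ext g
  simp only [CompactlySupportedContinuousMap.coe_sub, Pi.sub_apply,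
    CompactlySupportedContinuousMap.sup_apply, CompactlySupportedContinuousMap.coe_zero,
    CompactlySupportedContinuousMap.coe_neg, Pi.zero_apply, Pi.neg_apply]
  rcases le_total (u g) 0 with h | h
  · rw [max_eq_right h, max_eq_left (by linarith)]; ring
  · rw [max_eq_left h, max_eq_right (by linarith)]; ring

/-- The action of `G` on maps `C_c(G, ℝ) → E` by right translation of the argument. -/
def inducedAction (G E : Type*) [Group G] [TopologicalSpace G] [IsTopologicalGroup G]
    [AddCommGroup E] [Module ℝ E] :
    G →* ((C_c(G, ℝ) → E) →ᵃ[ℝ] (C_c(G, ℝ) → E)) where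
  toFun k := (LinearMap.funLeft ℝ E (translateCc (1 : G) k⁻¹)).toAffineMap
  map_one' := by
    ext T u
    simp [LinearMap.funLeft, show translateCc (1 : G) 1 u = u by ext; simp]
  map_mul' k l := by
    ext T u
    simp [LinearMap.funLeft, translateCc_translateCc]

theorem inducedAction_apply {G E : Type*} [Group G] [TopologicalSpace G] [IsTopologicalGroup G]
    [AddCommGroup E] [Module ℝ E] (k : G) (T : C_c(G, ℝ) → E) (u : C_c(G, ℝ)) :
    inducedAction G E k T u = T (translateCc 1 k⁻¹ u) := rfl

theorem isClosed_setOf_equivariant {G E : Type*} [Group G] [TopologicalSpace G]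
    [IsTopologicalGroup G] [AddCommGroup E] [Module ℝ E] [TopologicalSpace E] [T2Space E]
    (c : G → ℝ) {H : Subgroup G} {ρ : H →* (E →ᵃ[ℝ] E)} {K : Set E}
    (hK : IsConvexCompactGSpace ρ K) (h : H) (u : C_c(G, ℝ)) :
    IsClosed {T : C_c(G, ℝ) → E | T ((c h)⁻¹ • translateCc (h : G)⁻¹ 1 u) = ρ h (T u)} :=
  isClosed_eq (continuous_apply _) ((hK.continuous_apply h).comp (continuous_apply _))

/-- A `K`-valued measurable map, modulo null sets, on `G`, encoded by its integrals `T u` against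
the densities `u`: a linear map such that `T u` lies in `K` for every probability density `u`. -/
structure IsMeanMap {G : Type*} [TopologicalSpace G] [MeasurableSpace G] {E : Type*}
    [AddCommGroup E] [Module ℝ E] (ν : Measure G) (K : Set E) (T : C_c(G, ℝ) → E) : Prop where
  map_add : ∀ u v, T (u + v) = T u + T v
  map_smul : ∀ (a : ℝ) u, T (a • u) = a • T u
  mem : ∀ u, 0 ≤ u → T u ∈ (∫ g, u g ∂ν) • K

namespace IsMeanMap

variable {G : Type*} [TopologicalSpace G] [MeasurableSpace G] {E : Type*} [AddCommGroup E]
  [Module ℝ E] {ν : Measure G} {K : Set E} {T : C_c(G, ℝ) → E}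

theorem map_sub (hT : IsMeanMap ν K T) (u v : C_c(G, ℝ)) : T (u - v) = T u - T v := by
  have : u - v = u + (-1 : ℝ) • v := by
    ext; simp [sub_eq_add_neg]
  rw [this, hT.map_add, hT.map_smul, neg_one_smul, sub_eq_add_neg]

theorem eq_sub (hT : IsMeanMap ν K T) (u : C_c(G, ℝ)) : T u = T (u ⊔ 0) - T (-u ⊔ 0) := by
  rw [← hT.map_sub, ← u.eq_sup_sub_sup]

theorem mem_of_integral_eq_one (hT : IsMeanMap ν K T) {u : C_c(G, ℝ)} (hu : 0 ≤ u)
    (h1 : ∫ g, u g ∂ν = 1) : T u ∈ K := by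
  simpa [h1] using hT.mem u hu

variable [BorelSpace G] [TopologicalSpace E]

theorem abs_le (hT : IsMeanMap ν K T) [IsFiniteMeasureOnCompacts ν] {φ : E →L[ℝ] ℝ} {C : ℝ}
    (hC : ∀ x ∈ K, |φ x| ≤ C) (u : C_c(G, ℝ)) : |φ (T u)| ≤ C * ∫ g, |u g| ∂ν := by
  have hpos : ∀ v : C_c(G, ℝ), 0 ≤ v → |φ (T v)| ≤ C * ∫ g, v g ∂ν := fun v hv => by
    obtain ⟨x, hx, hxT⟩ := hT.mem v hv
    have h0 : 0 ≤ ∫ g, v g ∂ν := integral_nonneg hv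
    rw [← hxT, _root_.map_smul, smul_eq_mul, abs_mul, abs_of_nonneg h0, mul_comm]
    exact mul_le_mul_of_nonneg_right (hC x hx) h0
  calc |φ (T u)| = |φ (T (u ⊔ 0)) - φ (T (-u ⊔ 0))| := by rw [hT.eq_sub u, _root_.map_sub]
    _ ≤ |φ (T (u ⊔ 0))| + |φ (T (-u ⊔ 0))| := abs_sub _ _
    _ ≤ C * ∫ g, (u ⊔ 0) g ∂ν + C * ∫ g, (-u ⊔ 0) g ∂ν :=
      add_le_add (hpos _ le_sup_right) (hpos _ le_sup_right)
    _ = C * ∫ g, |u g| ∂ν := by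
      rw [← mul_add, ← integral_add ((u ⊔ 0).integrable' ν) ((-u ⊔ 0).integrable' ν)]
      congr 2
      funext g
      simp only [CompactlySupportedContinuousMap.sup_apply, CompactlySupportedContinuousMap.coe_neg,
        CompactlySupportedContinuousMap.coe_zero, Pi.zero_apply, Pi.neg_apply]
      rcases le_total (u g) 0 with h | h
      · rw [max_eq_right h, max_eq_left (by linarith), abs_of_nonpos h]; ring
      · rw [max_eq_left h, max_eq_right (by linarith), abs_of_nonneg h]; ring

variable [IsTopologicalAddGroup E] [ContinuousSMul ℝ E]

/-- Mean maps are equicontinuous for the `L¹`-norm. -/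
theorem exists_forall_mem [IsFiniteMeasureOnCompacts ν]
    (hK : IsCompact K) {U : Set E} (hU : U ∈ 𝓝 (0 : E)) :
    ∃ δ : ℝ, 0 < δ ∧ ∀ T : C_c(G, ℝ) → E, IsMeanMap ν K T → ∀ u : C_c(G, ℝ),
      ∫ g, |u g| ∂ν < δ → T u ∈ U := by
  obtain ⟨V, hV, hVU⟩ : ∃ V ∈ 𝓝 (0 : E), ∀ x ∈ V, ∀ y ∈ V, x - y ∈ U := by
    have : ContinuousAt (fun p : E × E => p.1 - p.2) (0, 0) := continuous_sub.continuousAt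
    have h := this.preimage_mem_nhds (by simpa using hU)
    rw [nhds_prod_eq] at h
    obtain ⟨V, hV, hVU⟩ := Filter.mem_prod_same_iff.1 h
    exact ⟨V, hV, fun x hx y hy => hVU (mk_mem_prod hx hy)⟩
  obtain ⟨δ, hδ, hδV⟩ := exists_forall_smul_mem_of_isCompact hK hV
  refine ⟨δ, hδ, fun T hT u hu => ?_⟩
  have hpart : ∀ v : C_c(G, ℝ), 0 ≤ v → (∀ g, v g ≤ |u g|) → T v ∈ V := fun v hv hvu => by
    obtain ⟨x, hx, hxT⟩ := hT.mem v hv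
    rw [← hxT]
    refine hδV _ ?_ x hx
    rw [abs_of_nonneg (integral_nonneg hv)]
    exact (integral_mono (v.integrable' ν) (u.integrable' ν).abs hvu).trans_lt hu
  rw [hT.eq_sub u]
  refine hVU _ (hpart _ le_sup_right fun g => ?_) _ (hpart _ le_sup_right fun g => ?_)
  · exact max_le (le_abs_self _) (abs_nonneg _)
  · exact max_le (neg_le_abs _) (abs_nonneg _)

end IsMeanMap

theorem isCompact_setOf_isMeanMap {G : Type*} [TopologicalSpace G] [MeasurableSpace G] {E : Type*}
    [AddCommGroup E] [Module ℝ E] [TopologicalSpace E] [IsTopologicalAddGroup E]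
    [ContinuousSMul ℝ E] [T2Space E] (ν : Measure G) {K : Set E} (hK : IsCompact K) :
    IsCompact {T : C_c(G, ℝ) → E | IsMeanMap ν K T} := by
  have hc : ∀ a : ℝ, IsCompact (a • K) := fun a => hK.smul a
  have hsub : ∀ a b : ℝ, IsCompact (a • K - b • K) := fun a b => by
    rw [← sub_image_prod]
    exact ((hc a).prod (hc b)).image continuous_sub
  refine (isCompact_univ_pi fun u : C_c(G, ℝ) =>
    hsub (∫ g, (u ⊔ 0) g ∂ν) (∫ g, (-u ⊔ 0) g ∂ν)).of_isClosed_subset ?_ ?_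
  · have : {T : C_c(G, ℝ) → E | IsMeanMap ν K T} =
        (⋂ (u) (v), {T | T (u + v) = T u + T v}) ∩ (⋂ (a : ℝ) (u), {T | T (a • u) = a • T u}) ∩
          ⋂ (u) (_ : 0 ≤ u), {T | T u ∈ (∫ g, u g ∂ν) • K} := by
      ext T
      simp only [mem_inter_iff, mem_iInter, mem_ofPred_eq]
      exact ⟨fun h => ⟨⟨h.map_add, h.map_smul⟩, h.mem⟩, fun h => ⟨h.1.1, h.1.2, h.2⟩⟩
    rw [this]
    refine ((isClosed_iInter fun u => isClosed_iInter fun v => ?_).inter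
      (isClosed_iInter fun a => isClosed_iInter fun u => ?_)).inter
      (isClosed_iInter fun u => isClosed_iInter fun _ => ?_)
    · exact isClosed_eq (continuous_apply _) ((continuous_apply u).add (continuous_apply v))
    · exact isClosed_eq (continuous_apply _) ((continuous_apply _).const_smul a)
    · exact (hc _).isClosed.preimage (continuous_apply _)
  · intro T hT u _
    rw [hT.eq_sub u]
    exact sub_mem_sub (hT.mem _ le_sup_right) (hT.mem _ le_sup_right)

variable {G : Type*} [Group G] [TopologicalSpace G] [IsTopologicalGroup G]
  [MeasurableSpace G] [BorelSpace G]
  {E : Type*} [AddCommGroup E] [Module ℝ E] [TopologicalSpace E]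

/-- The convex compact `G`-space induced from the `H`-space `K`: the mean maps which are equivariant
under left translations by `H`. The function `c` describes how left
translations scale `ν`, so that probability densities are translated to probability densities. -/
def inducedSet (ν : Measure G) (c : G → ℝ) {H : Subgroup G} (ρ : H →* (E →ᵃ[ℝ] E)) (K : Set E) :
    Set (C_c(G, ℝ) → E) :=
  {T | IsMeanMap ν K T ∧ ∀ (h : H) (u : C_c(G, ℝ)), 0 ≤ u → ∫ g, u g ∂ν = 1 →
    T ((c h)⁻¹ • translateCc (h : G)⁻¹ 1 u) = ρ h (T u)}

variable [IsTopologicalAddGroup E] [ContinuousSMul ℝ E] [T2Space E]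

/-- The induced space is a convex compact `G`-space. The action is jointly continuous because
translation is continuous in `L¹`. -/
theorem isConvexCompactGSpace_inducedSet [LocallyCompactSpace G] (ν : Measure G)
    [IsFiniteMeasureOnCompacts ν]
    [ν.IsMulRightInvariant] (c : G → ℝ) {H : Subgroup G} {ρ : H →* (E →ᵃ[ℝ] E)} {K : Set E}
    (hK : IsConvexCompactGSpace ρ K) :
    IsConvexCompactGSpace (inducedAction G E) (inducedSet ν c ρ K) where
  convex := by
    rintro T ⟨hT, hTe⟩ S ⟨hS, hSe⟩ a b ha hb hab
    refine ⟨⟨fun u v => ?_, fun r u => ?_, fun u hu => ?_⟩, fun h u hu h1 => ?_⟩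
    · simp only [Pi.add_apply, Pi.smul_apply, hT.map_add, hS.map_add, smul_add]
      abel
    · simp only [Pi.add_apply, Pi.smul_apply, hT.map_smul, hS.map_smul, smul_add, smul_comm r]
    · exact hK.convex.smul _ (hT.mem u hu) (hS.mem u hu) ha hb hab
    · simp only [Pi.add_apply, Pi.smul_apply, hTe h u hu h1, hSe h u hu h1]
      exact (Convex.combo_affine_apply hab).symm
  isCompact := by
    have : inducedSet ν c ρ K = {T | IsMeanMap ν K T} ∩ ⋂ (h : H) (u : C_c(G, ℝ)) (_ : 0 ≤ u)
        (_ : ∫ g, u g ∂ν = 1), {T | T ((c h)⁻¹ • translateCc (h : G)⁻¹ 1 u) = ρ h (T u)} := by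
      ext T
      simp [inducedSet]
    rw [this]
    exact (isCompact_setOf_isMeanMap ν hK.isCompact).inter_right (isClosed_iInter fun h =>
      isClosed_iInter fun u => isClosed_iInter fun _ => isClosed_iInter fun _ =>
        isClosed_setOf_equivariant c hK h u)
  continuous_apply k := continuous_pi fun u => continuous_apply (translateCc 1 k⁻¹ u)
  mapsTo k := by
    rintro T ⟨hT, hTe⟩
    refine ⟨⟨fun u v => ?_, fun r u => ?_, fun u hu => ?_⟩, fun h u hu h1 => ?_⟩
    · simp only [inducedAction_apply, translateCc_add, hT.map_add]
    · simp only [inducedAction_apply, translateCc_smul, hT.map_smul]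
    · rw [inducedAction_apply, ← integral_translateCc_right ν k⁻¹ u]
      exact hT.mem _ (translateCc_nonneg _ _ hu)
    · rw [inducedAction_apply, inducedAction_apply, ← hTe h _ (translateCc_nonneg _ _ hu)
        ((integral_translateCc_right ν k⁻¹ u).trans h1), translateCc_smul, translateCc_translateCc,
        translateCc_translateCc]
      simp
  continuousOn := by
    refine continuousOn_pi.2 fun u => ?_
    rintro ⟨k₀, T₀⟩ ⟨-, hT₀⟩
    have hsplit : ∀ p ∈ (univ : Set G) ×ˢ inducedSet ν c ρ K,
        p.2 (translateCc 1 p.1⁻¹ u - translateCc 1 k₀⁻¹ u) + p.2 (translateCc 1 k₀⁻¹ u) =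
          inducedAction G E p.1 p.2 u := fun p hp => by
      rw [hp.2.1.map_sub, sub_add_cancel, inducedAction_apply]
    refine (Filter.Tendsto.congr' (f₁ := fun p : G × (C_c(G, ℝ) → E) =>
        p.2 (translateCc 1 p.1⁻¹ u - translateCc 1 k₀⁻¹ u) + p.2 (translateCc 1 k₀⁻¹ u))
      (Filter.eventually_of_mem self_mem_nhdsWithin hsplit) ?_)
    have h2 : Filter.Tendsto (fun p : G × (C_c(G, ℝ) → E) => p.2 (translateCc 1 k₀⁻¹ u))
        (𝓝[univ ×ˢ inducedSet ν c ρ K] (k₀, T₀)) (𝓝 (T₀ (translateCc 1 k₀⁻¹ u))) :=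
      (((continuous_apply (translateCc 1 k₀⁻¹ u)).comp continuous_snd).tendsto _).mono_left
        nhdsWithin_le_nhds
    have h1 : Filter.Tendsto (fun p : G × (C_c(G, ℝ) → E) =>
        p.2 (translateCc 1 p.1⁻¹ u - translateCc 1 k₀⁻¹ u))
        (𝓝[univ ×ˢ inducedSet ν c ρ K] (k₀, T₀)) (𝓝 0) := by
      intro U hU
      obtain ⟨δ, hδ, hδU⟩ := IsMeanMap.exists_forall_mem (ν := ν) hK.isCompact hU
      have hev : ∀ᶠ p : G × (C_c(G, ℝ) → E) in 𝓝[univ ×ˢ inducedSet ν c ρ K] (k₀, T₀),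
          ∫ g, |(translateCc 1 p.1⁻¹ u - translateCc 1 k₀⁻¹ u) g| ∂ν < δ :=
        (((tendsto_integral_abs_translateCc_sub ν u k₀).comp (continuous_fst.tendsto (k₀, T₀))
          ).mono_left nhdsWithin_le_nhds).eventually (gt_mem_nhds hδ)
      refine Filter.mem_map.2 ?_
      filter_upwards [hev, self_mem_nhdsWithin] with p hp hpK
      exact hδU p.2 hpK.2.1 _ hp
    simpa [inducedAction_apply] using h1.add h2

end Induced

/-! ### The induced space is non-empty -/

section Nonempty

open scoped CompactlySupported Pointwise

variable {G : Type*} [Group G] [TopologicalSpace G] [IsTopologicalGroup G] [LocallyCompactSpace G]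
  [MeasurableSpace G] [BorelSpace G] {H : Subgroup G}

/-- Averaging a compactly supported function on `G` over a closed subgroup against a continuous
function yields a continuous function. -/
theorem continuous_integral_subgroup (hH : IsClosed (H : Set G)) (η : Measure H)
    [IsFiniteMeasureOnCompacts η] (b : C_c(G, ℝ)) {ψ : H → ℝ} (hψ : Continuous ψ) :
    Continuous fun g : G => ∫ k : H, b ((k : G)⁻¹ * g) * ψ k ∂η := by
  refine continuous_iff_continuousAt.2 fun g₀ => ?_
  obtain ⟨N, hN, hNg⟩ := exists_compact_mem_nhds g₀
  have hC : IsCompact ((↑) ⁻¹' (N * (tsupport b)⁻¹) : Set H) :=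
    hH.isClosedEmbedding_subtypeVal.isCompact_preimage (hN.mul b.hasCompactSupport.isCompact.inv)
  refine continuousAt_integral_of_locally_compact_support
    (F := fun (g : G) (k : H) => b ((k : G)⁻¹ * g) * ψ k) ?_ hNg hC fun g hg k hk => ?_
  · unfold Function.uncurry
    fun_prop
  · have : b ((k : G)⁻¹ * g) = 0 := by
      by_contra hne
      exact hk ⟨g, hg, ((k : G)⁻¹ * g)⁻¹, Set.inv_mem_inv.2 (subset_tsupport _ hne), by simp⟩
    rw [this, zero_mul]

/-- The signed version of `exists_weak_integral`. -/
theorem exists_weak_integral_signed {X E : Type*} [TopologicalSpace X]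
    [MeasurableSpace X] [BorelSpace X] [AddCommGroup E] [Module ℝ E] [TopologicalSpace E]
    [IsTopologicalAddGroup E] [ContinuousSMul ℝ E] {ν : Measure X} [IsFiniteMeasureOnCompacts ν]
    {K : Set E}
    (hK : Convex ℝ K) (hKc : IsCompact K) (hKn : K.Nonempty) {F : X → E} (hFK : ∀ x, F x ∈ K)
    (hF : ∀ φ : E →L[ℝ] ℝ, Continuous fun x => φ (F x)) (u : C_c(X, ℝ)) :
    ∃ e : E, ∀ φ : E →L[ℝ] ℝ, φ e = ∫ g, u g * φ (F g) ∂ν := by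
  have hpos : ∀ v : C_c(X, ℝ), 0 ≤ v → ∃ e : E, ∀ φ : E →L[ℝ] ℝ, φ e = ∫ g, v g * φ (F g) ∂ν :=
    fun v hv => by
      obtain ⟨x, -, hx⟩ := exists_weak_integral hK hKc hKn ν hFK hF v.continuous
        v.hasCompactSupport hv
      exact ⟨_, hx⟩
  obtain ⟨e₁, he₁⟩ := hpos (u ⊔ 0) le_sup_right
  obtain ⟨e₂, he₂⟩ := hpos (-u ⊔ 0) le_sup_right
  refine ⟨e₁ - e₂, fun φ => ?_⟩
  have hint : ∀ v : C_c(X, ℝ), Integrable (fun g => v g * φ (F g)) ν := fun v =>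
    integrable_mul_of_hasCompactSupport v.continuous v.hasCompactSupport (hF φ)
  rw [map_sub, he₁, he₂, ← integral_sub (hint _) (hint _)]
  refine integral_congr_ae (Filter.Eventually.of_forall fun g => ?_)
  have := DFunLike.congr_fun u.eq_sup_sub_sup g
  simp only [this, ← sub_mul]
  rfl

variable {E : Type*} [AddCommGroup E] [Module ℝ E] [TopologicalSpace E]
  [IsTopologicalAddGroup E] [ContinuousSMul ℝ E] [LocallyConvexSpace ℝ E] [T2Space E]

/-- There are weakly continuous maps `G → K` which are `H`-equivariant on a given compact set: the
orbit map of a point of `K` is averaged over `H` with a weight which is positive on this set. -/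
theorem exists_equivariant_on_compact (hH : IsClosed (H : Set G)) {ρ : H →* (E →ᵃ[ℝ] E)}
    {K : Set E} (hK : IsConvexCompactGSpace ρ K) (hKn : K.Nonempty) {C : Set G} (hC : IsCompact C) :
    ∃ F : G → E, (∀ g, F g ∈ K) ∧ (∀ φ : E →L[ℝ] ℝ, Continuous fun g => φ (F g)) ∧
      ∀ (h : H), ∀ g ∈ C, F (h * g) = ρ h (F g) := by
  obtain ⟨x₀, hx₀⟩ := hKn
  have : LocallyCompactSpace H := hH.isClosedEmbedding_subtypeVal.locallyCompactSpace
  let η : Measure H := Measure.haar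
  obtain ⟨b₀, hbC, -, hbc, hb01⟩ := exists_continuous_one_zero_of_isCompact hC isClosed_empty
    (disjoint_empty C)
  let b : C_c(G, ℝ) := ⟨b₀, hbc⟩
  have hb0 : ∀ g, 0 ≤ b g := fun g => (hb01 g).1
  have horb : Continuous fun k : H => ρ k x₀ :=
    (hK.continuousOn.comp_continuous (Continuous.prodMk_left x₀) fun k => ⟨mem_univ _, hx₀⟩)
  have hbcont : ∀ g : G, Continuous fun k : H => b ((k : G)⁻¹ * g) := fun g => by fun_prop
  have hbsupp : ∀ g : G, HasCompactSupport fun k : H => b ((k : G)⁻¹ * g) := fun g => by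
    have h1 : HasCompactSupport fun k : G => b (k⁻¹ * g) :=
      b.hasCompactSupport.comp_homeomorph ((Homeomorph.inv G).trans (Homeomorph.mulRight g))
    exact h1.comp_isClosedEmbedding hH.isClosedEmbedding_subtypeVal
  set B : G → ℝ := fun g => ∫ k : H, b ((k : G)⁻¹ * g) ∂η with hB
  have hBcont : Continuous B := by
    simpa using continuous_integral_subgroup hH η b (continuous_const (y := (1 : ℝ)))
  have hB0 : ∀ g, 0 ≤ B g := fun g => integral_nonneg fun k => hb0 _
  have hBH : ∀ (h : H) (g : G), B (h * g) = B g := fun h g => by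
    rw [hB]
    simpa [mul_assoc] using
      (integral_mul_left_eq_self (μ := η) (fun k : H => b ((k : G)⁻¹ * (h * g))) h).symm
  have hBC : ∀ g ∈ C, 0 < B g := fun g hg => by
    refine (hbcont g).integral_pos_of_hasCompactSupport_nonneg_nonzero (hbsupp g)
      (fun k => hb0 _) (x := 1) ?_
    have : b g = 1 := hbC hg
    simp [this]
  obtain ⟨s, hs0, hs⟩ : ∃ s : ℝ, 0 < s ∧ ∀ g ∈ C, s ≤ B g := by
    rcases C.eq_empty_or_nonempty with rfl | hne
    · exact ⟨1, one_pos, by simp⟩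
    · obtain ⟨g, hg, hmin⟩ := hC.exists_isMinOn hne hBcont.continuousOn
      exact ⟨B g, hBC g hg, fun g' hg' => hmin hg'⟩
  choose y hyK hy using fun g : G => exists_weak_integral hK.convex hK.isCompact ⟨x₀, hx₀⟩ η
    (F := fun k : H => ρ k x₀) (fun k => hK.mapsTo k hx₀) (fun φ => φ.continuous.comp horb)
    (hbcont g) (hbsupp g) fun k => hb0 _
  -- the average is normalised where `B` is large, and elsewhere completed by a multiple of `x₀`
  set q : G → ℝ := fun g => (max (B g) s)⁻¹ with hq
  have hmax : ∀ g, 0 < max (B g) s := fun g => lt_max_of_lt_right hs0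
  have hqcont : Continuous q := (hBcont.max continuous_const).inv₀ fun g => (hmax g).ne'
  have hqB : ∀ g, q g * B g ≤ 1 := fun g => by
    rw [hq]
    exact (inv_mul_le_iff₀ (hmax g)).2 (by rw [mul_one]; exact le_max_left _ _)
  have hqB0 : ∀ g, 0 ≤ q g * B g := fun g => mul_nonneg (inv_nonneg.2 (hmax g).le) (hB0 g)
  have hqC : ∀ g ∈ C, q g * B g = 1 := fun g hg => by
    simp only [hq, max_eq_left (hs g hg)]
    exact inv_mul_cancel₀ (hBC g hg).ne'
  let F : G → E := fun g => (q g * B g) • y g + (1 - q g * B g) • x₀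
  have hF : ∀ (φ : E →L[ℝ] ℝ) (g : G), φ (F g) =
      q g * ∫ k : H, b ((k : G)⁻¹ * g) * φ (ρ k x₀) ∂η + (1 - q g * B g) * φ x₀ := fun φ g => by
    have := hy g φ
    rw [map_smul, smul_eq_mul] at this
    simp only [F, map_add, map_smul, smul_eq_mul, ← this, hB]
    ring
  refine ⟨F, fun g => ?_, fun φ => ?_, fun h g hg => ?_⟩
  · exact hK.convex (hyK g) hx₀ (hqB0 g) (by linarith [hqB g]) (by ring)
  · simp only [hF]
    have := continuous_integral_subgroup hH η b (φ.continuous.comp horb)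
    exact (hqcont.mul this).add ((continuous_const.sub (hqcont.mul hBcont)).mul continuous_const)
  · refine eq_of_forall_functional fun φ => ?_
    obtain ⟨ψ, a, hψ⟩ := exists_functional_comp_affine φ (ρ h) (hK.continuous_apply h)
    have hqh : q (h * g) = q g := by simp only [hq, hBH]
    have hint : Integrable (fun k : H => b ((k : G)⁻¹ * g)) η :=
      (hbcont g).integrable_of_hasCompactSupport (hbsupp g)
    have hint' : Integrable (fun k : H => b ((k : G)⁻¹ * g) * ψ (ρ k x₀)) η :=
      integrable_mul_of_hasCompactSupport (hbcont g) (hbsupp g) (ψ.continuous.comp horb)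
    have hshift : ∫ k : H, b ((k : G)⁻¹ * (h * g)) * φ (ρ k x₀) ∂η =
        ∫ k : H, b ((k : G)⁻¹ * g) * ψ (ρ k x₀) ∂η + B g * a := by
      rw [← integral_mul_left_eq_self (μ := η)
          (fun k : H => b ((k : G)⁻¹ * (h * g)) * φ (ρ k x₀)) h, hB,
          ← integral_mul_const, ← integral_add hint' (hint.mul_const a)]
      refine integral_congr_ae (Filter.Eventually.of_forall fun k => ?_)
      have : ρ (h * k) x₀ = ρ h (ρ k x₀) := by rw [map_mul]; rfl
      simp only [this, hψ]
      simp only [Subgroup.coe_mul, mul_inv_rev, mul_assoc, inv_mul_cancel_left]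
      ring
    rw [hF, hψ, hF, hqh, hBH, hshift, hqC g hg, mul_add, ← mul_assoc, hqC g hg]
    ring

/-- By compactness, equivariance has to be achieved only for finitely many densities at a time,
hence only on a compact subset of `G`. -/
theorem inducedSet_nonempty {ν : Measure G} [IsFiniteMeasureOnCompacts ν] {c : G → ℝ}
    (hc0 : ∀ h, 0 < c h)
    (hc : ∀ (h : G) (u : C_c(G, ℝ)), ∫ g, u (h⁻¹ * g) ∂ν = c h * ∫ g, u g ∂ν)
    (hH : IsClosed (H : Set G)) {ρ : H →* (E →ᵃ[ℝ] E)} {K : Set E}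
    (hK : IsConvexCompactGSpace ρ K) (hKn : K.Nonempty) : (inducedSet ν c ρ K).Nonempty := by
  classical
  let ι := {p : H × C_c(G, ℝ) // 0 ≤ p.2 ∧ ∫ g, p.2 g ∂ν = 1}
  obtain ⟨T, hT, hTe⟩ := (isCompact_setOf_isMeanMap ν hK.isCompact).inter_iInter_nonempty
    (fun p : ι => {T : C_c(G, ℝ) → E |
      T ((c p.1.1)⁻¹ • translateCc (p.1.1 : G)⁻¹ 1 p.1.2) = ρ p.1.1 (T p.1.2)})
    (fun p => isClosed_setOf_equivariant c hK _ _) fun s => by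
      have hC : IsCompact (⋃ p ∈ s, tsupport p.1.2) :=
        s.isCompact_biUnion fun p _ => p.1.2.hasCompactSupport.isCompact
      obtain ⟨F, hFK, hF, hFe⟩ := exists_equivariant_on_compact hH hK hKn hC
      have hint : ∀ (φ : E →L[ℝ] ℝ) (u : C_c(G, ℝ)), Integrable (fun g => u g * φ (F g)) ν :=
        fun φ u => integrable_mul_of_hasCompactSupport u.continuous u.hasCompactSupport (hF φ)
      choose T hT using exists_weak_integral_signed (ν := ν) hK.convex hK.isCompact hKn hFK hF
      refine ⟨T, ⟨fun u v => ?_, fun a u => ?_, fun u hu => ?_⟩, mem_iInter₂.2 fun p hp => ?_⟩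
      · refine eq_of_forall_functional fun φ => ?_
        rw [map_add, hT, hT, hT, ← integral_add (hint φ u) (hint φ v)]
        simp [add_mul]
      · refine eq_of_forall_functional fun φ => ?_
        rw [map_smul, hT, hT, smul_eq_mul, ← integral_const_mul]
        simp [mul_assoc]
      · obtain ⟨x, hx, hxu⟩ := exists_weak_integral hK.convex hK.isCompact hKn ν hFK hF u.continuous
          u.hasCompactSupport hu
        exact ⟨x, hx, eq_of_forall_functional fun φ => (hxu φ).trans (hT u φ).symm⟩
      · obtain ⟨⟨h, u⟩, hu0, hu1⟩ := p
        refine eq_of_forall_functional fun φ => ?_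
        obtain ⟨ψ, a, hψ⟩ := exists_functional_comp_affine φ (ρ h) (hK.continuous_apply h)
        let v : C_c(G, ℝ) := ⟨⟨fun g => u g * φ (F (h * g)),
          u.continuous.mul ((hF φ).comp (continuous_const_mul (h : G)))⟩,
          u.hasCompactSupport.mul_right⟩
        have hv : ∀ g, v g = u g * ψ (F g) + u g * a := fun g => by
          by_cases hg : g ∈ tsupport u
          · change u g * φ (F (h * g)) = _
            rw [hFe h g (mem_iUnion₂.2 ⟨_, hp, hg⟩), hψ, mul_add]
          · change u g * φ (F (h * g)) = _
            simp [image_eq_zero_of_notMem_tsupport hg]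
        have key := hc h v
        have e1 : ∀ g, v ((h : G)⁻¹ * g) = u ((h : G)⁻¹ * g) * φ (F g) := fun g => by
          change u _ * φ (F (h * ((h : G)⁻¹ * g))) = _
          rw [mul_inv_cancel_left]
        simp only [e1, hv] at key
        rw [integral_add (hint ψ u) ((u.integrable' ν).mul_const a), integral_mul_const, hu1,
          one_mul] at key
        change φ (T _) = φ (ρ h (T u))
        rw [hψ, hT, hT]
        simp only [CompactlySupportedContinuousMap.coe_smul, Pi.smul_apply, smul_eq_mul,
          translateCc_apply, mul_one, mul_assoc]
        rw [integral_const_mul, key, inv_mul_cancel_left₀ (hc0 h).ne']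
  exact ⟨T, hT, fun h u hu h1 => mem_iInter.1 hTe ⟨(h, u), hu, h1⟩⟩

end Nonempty

/-! ### Convolution -/

section Convolution

open scoped CompactlySupported Pointwise

variable {G : Type*} [Group G] [TopologicalSpace G] [IsTopologicalGroup G]
  [MeasurableSpace G] [BorelSpace G]

/-- The convolution `g ↦ ∫ ω (g * y⁻¹) * ω' y ∂ν`, which for a right Haar measure `ν` is the density
of the convolution of the measures with densities `ω` and `ω'`. -/
noncomputable def convolutionCc (ν : Measure G) [IsFiniteMeasureOnCompacts ν] (ω ω' : C_c(G, ℝ)) :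
    C_c(G, ℝ) where
  toFun g := ∫ y, ω (g * y⁻¹) * ω' y ∂ν
  continuous_toFun := continuous_iff_continuousAt.2 fun g₀ =>
    continuousAt_integral_of_locally_compact_support
      (F := fun g y : G => ω (g * y⁻¹) * ω' y) (by unfold Function.uncurry; fun_prop)
      Filter.univ_mem ω'.hasCompactSupport.isCompact fun g _ y hy => by
        rw [image_eq_zero_of_notMem_tsupport hy, mul_zero]
  hasCompactSupport' := by
    refine HasCompactSupport.of_support_subset_isCompact
      (ω.hasCompactSupport.isCompact.mul ω'.hasCompactSupport.isCompact) fun g hg => ?_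
    by_contra hne
    refine hg (integral_eq_zero_of_ae (Filter.Eventually.of_forall fun y => ?_))
    by_cases hy : y ∈ tsupport ω'
    · have : g * y⁻¹ ∉ tsupport ω := fun h => hne ⟨g * y⁻¹, h, y, hy, by simp⟩
      simp [image_eq_zero_of_notMem_tsupport this]
    · simp [image_eq_zero_of_notMem_tsupport hy]

variable {ν : Measure G} [IsFiniteMeasureOnCompacts ν]

theorem convolutionCc_apply (ω ω' : C_c(G, ℝ)) (g : G) :
    convolutionCc ν ω ω' g = ∫ y, ω (g * y⁻¹) * ω' y ∂ν := rfl

theorem convolutionCc_apply' [ν.IsMulRightInvariant] (ω ω' : C_c(G, ℝ)) (g : G) :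
    convolutionCc ν ω ω' g = ∫ y, ω y⁻¹ * ω' (y * g) ∂ν := by
  rw [convolutionCc_apply, ← integral_mul_right_eq_self (fun y => ω (g * y⁻¹) * ω' y) g]
  simp

theorem translateCc_convolutionCc [ν.IsMulRightInvariant] (ω ω' : C_c(G, ℝ)) (b : G) :
    translateCc 1 b (convolutionCc ν ω ω') = convolutionCc ν ω (translateCc 1 b ω') := by
  ext g
  simp only [translateCc_apply, one_mul, convolutionCc_apply', mul_assoc]

/-- Integration of a translate depends continuously on the translation. -/
theorem continuous_integral_translateCc [LocallyCompactSpace G] (σ : Measure G)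
    [IsFiniteMeasureOnCompacts σ]
    (u : C_c(G, ℝ)) : Continuous fun y : G => ∫ g, u (g * y⁻¹) ∂σ := by
  refine continuous_iff_continuousAt.2 fun y₀ => ?_
  obtain ⟨N, hN, hNy⟩ := exists_compact_mem_nhds y₀
  refine continuousAt_integral_of_locally_compact_support (F := fun y g : G => u (g * y⁻¹))
    (by unfold Function.uncurry; fun_prop) hNy (u.hasCompactSupport.isCompact.mul hN)
    fun y hy g hg => ?_
  by_contra hne
  exact hg ⟨g * y⁻¹, subset_tsupport _ hne, y, hy, by simp⟩

theorem integral_convolutionCc (σ : Measure G) [IsFiniteMeasureOnCompacts σ] (ω ω' : C_c(G, ℝ)) :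
    ∫ g, convolutionCc ν ω ω' g ∂σ = ∫ y, ω' y * ∫ g, ω (g * y⁻¹) ∂σ ∂ν := by
  simp only [convolutionCc_apply]
  rw [integral_integral_swap_of_hasCompactSupport (f := fun g y : G => ω (g * y⁻¹) * ω' y)]
  · simp only [integral_mul_const, mul_comm]
  · unfold Function.uncurry
    fun_prop
  · refine HasCompactSupport.intro ((ω.hasCompactSupport.isCompact.mul
      ω'.hasCompactSupport.isCompact).prod ω'.hasCompactSupport.isCompact) ?_
    rintro ⟨g, y⟩ hgy
    by_cases hy : y ∈ tsupport ω'
    · have : g * y⁻¹ ∉ tsupport ω := fun h =>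
        hgy ⟨⟨g * y⁻¹, h, y, hy, by simp⟩, hy⟩
      simp [image_eq_zero_of_notMem_tsupport this]
    · simp [image_eq_zero_of_notMem_tsupport hy]

/-- Symmetric probability densities supported near the identity form a left approximate unit for
convolution in `L¹`. Symmetry makes the modular function disappear. -/
theorem exists_nhds_integral_abs_convolutionCc_sub_le [LocallyCompactSpace G]
    [ν.IsMulRightInvariant] (ω' : C_c(G, ℝ)) {δ : ℝ} (hδ : 0 < δ) :
    ∃ V ∈ 𝓝 (1 : G), ∀ ω : C_c(G, ℝ), 0 ≤ ω → (∀ g, ω g⁻¹ = ω g) → ∫ g, ω g ∂ν = 1 →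
      (∀ g, ω g ≠ 0 → g ∈ V) → ∫ g, |(convolutionCc ν ω ω' - ω') g| ∂ν ≤ δ := by
  obtain ⟨N, hN, hN1⟩ := exists_compact_mem_nhds (1 : G)
  have hK' := ω'.hasCompactSupport.isCompact
  have hcont : ContinuousAt (fun y : G => ∫ g, |ω' (y * g) - ω' g| ∂ν) 1 := by
    refine continuousAt_integral_of_locally_compact_support
      (F := fun y g : G => |ω' (y * g) - ω' g|) (by unfold Function.uncurry; fun_prop) hN1
      (hN.inv.mul hK') fun y hy g hg => ?_
    have hy' : ∀ y ∈ N, ω' (y * g) = 0 := fun y hy => by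
      by_contra hne
      exact hg ⟨y⁻¹, Set.inv_mem_inv.2 hy, y * g, subset_tsupport _ hne, by simp⟩
    have h1 := hy' 1 (mem_of_mem_nhds hN1)
    rw [one_mul] at h1
    rw [hy' y hy, h1, sub_zero, abs_zero]
  have hV : {y : G | ∫ g, |ω' (y * g) - ω' g| ∂ν < δ} ∈ 𝓝 (1 : G) :=
    hcont.eventually (gt_mem_nhds (by simpa using hδ))
  refine ⟨_, hV, fun ω hω hsymm h1 hsupp => ?_⟩
  have hK := ω.hasCompactSupport.isCompact
  let D : G → G → ℝ := fun g y => ω y * |ω' (y * g) - ω' g|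
  have hDcont : Continuous (Function.uncurry D) := by
    unfold Function.uncurry
    fun_prop
  have hDzero : ∀ g y, (g ∉ tsupport ω' ∪ (tsupport ω)⁻¹ * tsupport ω' ∨ y ∉ tsupport ω) →
      D g y = 0 := by
    intro g y h
    by_cases hy : y ∈ tsupport ω
    · have hg := h.resolve_right (not_not.2 hy)
      have e1 : g ∉ tsupport ω' := fun h => hg (Or.inl h)
      have e2 : y * g ∉ tsupport ω' := fun h =>
        hg (Or.inr ⟨y⁻¹, Set.inv_mem_inv.2 hy, y * g, h, by simp⟩)
      simp [D, image_eq_zero_of_notMem_tsupport e1, image_eq_zero_of_notMem_tsupport e2]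
    · simp [D, image_eq_zero_of_notMem_tsupport hy]
  have hKK := hK'.union (hK.inv.mul hK')
  have hDsupp : HasCompactSupport (Function.uncurry D) := by
    refine HasCompactSupport.intro (hKK.prod hK) ?_
    rintro ⟨g, y⟩ hgy
    refine hDzero g y ?_
    by_contra hcon
    push Not at hcon
    exact hgy ⟨hcon.1, hcon.2⟩
  have hDint : Integrable (fun g => ∫ y, D g y ∂ν) ν := by
    refine Continuous.integrable_of_hasCompactSupport (continuous_iff_continuousAt.2 fun g₀ =>
      continuousAt_integral_of_locally_compact_support hDcont Filter.univ_mem hK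
        fun g _ y hy => hDzero g y (Or.inr hy)) (HasCompactSupport.intro hKK fun g hg => ?_)
    simp [hDzero g _ (Or.inl hg)]
  have hpt : ∀ g, |(convolutionCc ν ω ω' - ω') g| ≤ ∫ y, D g y ∂ν := fun g => by
    have hi : Integrable (fun y => ω y * ω' (y * g)) ν :=
      integrable_mul_of_hasCompactSupport ω.continuous ω.hasCompactSupport
        (ω'.continuous.comp (continuous_mul_const g))
    have : (convolutionCc ν ω ω' - ω') g = ∫ y, ω y * (ω' (y * g) - ω' g) ∂ν := by
      simp only [CompactlySupportedContinuousMap.coe_sub, Pi.sub_apply, convolutionCc_apply', hsymm,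
        mul_sub]
      rw [integral_sub hi ((ω.integrable' ν).mul_const _), integral_mul_const, h1, one_mul]
    rw [this]
    refine abs_integral_le_integral_abs.trans (le_of_eq ?_)
    refine integral_congr_ae (Filter.Eventually.of_forall fun y => ?_)
    simp only [D, abs_mul, abs_of_nonneg (hω y)]
  have hmono : ∀ y, ω y * ∫ g, |ω' (y * g) - ω' g| ∂ν ≤ ω y * δ := fun y => by
    by_cases hy : ω y = 0
    · simp [hy]
    · exact mul_le_mul_of_nonneg_left (hsupp y hy : _ < δ).le (hω y)
  calc ∫ g, |(convolutionCc ν ω ω' - ω') g| ∂ν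
      ≤ ∫ g, ∫ y, D g y ∂ν ∂ν :=
        integral_mono ((convolutionCc ν ω ω' - ω').integrable' ν).abs hDint hpt
    _ = ∫ y, ω y * ∫ g, |ω' (y * g) - ω' g| ∂ν ∂ν := by
        rw [integral_integral_swap_of_hasCompactSupport hDcont hDsupp]
        simp only [D, integral_const_mul]
    _ ≤ ∫ y, ω y * δ ∂ν :=
        integral_mono_of_nonneg (Filter.Eventually.of_forall fun y =>
          mul_nonneg (hω y) (integral_nonneg fun g => abs_nonneg _))
          ((ω.integrable' ν).mul_const δ) (Filter.Eventually.of_forall hmono)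
    _ = δ := by rw [integral_mul_const, h1, one_mul]

/-- There are symmetric probability densities supported in any neighbourhood of the identity. -/
theorem exists_symmetric_density [LocallyCompactSpace G] [T2Space G] (ν : Measure G)
    [IsFiniteMeasureOnCompacts ν] [ν.IsOpenPosMeasure] {V : Set G} (hV : V ∈ 𝓝 (1 : G)) :
    ∃ ω : C_c(G, ℝ), 0 ≤ ω ∧ (∀ g, ω g⁻¹ = ω g) ∧ ∫ g, ω g ∂ν = 1 ∧ ∀ g, ω g ≠ 0 → g ∈ V := by
  obtain ⟨f, hf1, hfV, hfc, hf01⟩ := exists_continuous_one_zero_of_isCompact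
    (isCompact_singleton (x := (1 : G))) (isOpen_interior (s := V)).isClosed_compl
    (disjoint_compl_right_iff_subset.2 (singleton_subset_iff.2 (mem_interior_iff_mem_nhds.2 hV)))
  let w : C_c(G, ℝ) := ⟨⟨fun g => f g * f g⁻¹, by fun_prop⟩, hfc.mul_right⟩
  have hw0 : 0 ≤ w := fun g => mul_nonneg (hf01 g).1 (hf01 g⁻¹).1
  have hw1 : w 1 ≠ 0 := by
    have : f 1 = 1 := hf1 rfl
    change f 1 * f 1⁻¹ ≠ 0
    simp [this]
  have hI : 0 < ∫ g, w g ∂ν :=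
    w.continuous.integral_pos_of_hasCompactSupport_nonneg_nonzero w.hasCompactSupport hw0 hw1
  refine ⟨(∫ g, w g ∂ν)⁻¹ • w, fun g => mul_nonneg (inv_nonneg.2 hI.le) (hw0 g), fun g => ?_, ?_,
    fun g hg => ?_⟩
  · change (∫ g, w g ∂ν)⁻¹ * (f g⁻¹ * f g⁻¹⁻¹) = (∫ g, w g ∂ν)⁻¹ * (f g * f g⁻¹)
    rw [inv_inv, mul_comm (f g)]
  · simp only [CompactlySupportedContinuousMap.coe_smul, Pi.smul_apply, smul_eq_mul]
    rw [integral_const_mul, inv_mul_cancel₀ hI.ne']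
  · by_contra hgV
    refine hg ?_
    have : f g = 0 := hfV fun h => hgV (interior_subset h)
    change (∫ g, w g ∂ν)⁻¹ * (f g * f g⁻¹) = 0
    rw [this, zero_mul, mul_zero]

variable {E : Type*} [AddCommGroup E] [Module ℝ E] [TopologicalSpace E]

/-- Mean maps commute with convolution from the right, tested on functionals. After adding
a multiple of `ν`, a functional of a mean map becomes positive, hence is given by a measure, and
Fubini's theorem applies. -/
theorem IsMeanMap.apply_convolutionCc [LocallyCompactSpace G] [T2Space G] {K : Set E}
    (hK : IsCompact K) {T : C_c(G, ℝ) → E} (hT : IsMeanMap ν K T) (φ : E →L[ℝ] ℝ)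
    (ω ω' : C_c(G, ℝ)) :
    φ (T (convolutionCc ν ω ω')) = ∫ y, ω' y * φ (T (translateCc 1 y⁻¹ ω)) ∂ν := by
  obtain ⟨C, -, hC⟩ := exists_forall_mem_abs_le hK φ
  let Λ : C_c(G, ℝ) →ₚ[ℝ] ℝ := PositiveLinearMap.mk₀
    { toFun := fun u => φ (T u) + C * ∫ g, u g ∂ν
      map_add' := fun u v => by
        simp only [hT.map_add, _root_.map_add, CompactlySupportedContinuousMap.coe_add,
          Pi.add_apply]
        rw [integral_add (u.integrable' ν) (v.integrable' ν)]
        ring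
      map_smul' := fun a u => by
        simp only [hT.map_smul, _root_.map_smul, CompactlySupportedContinuousMap.coe_smul,
          Pi.smul_apply, smul_eq_mul, RingHom.id_apply]
        rw [integral_const_mul]
        ring }
    fun u hu => by
      change 0 ≤ φ (T u) + C * ∫ g, u g ∂ν
      have e : ∫ g, |u g| ∂ν = ∫ g, u g ∂ν :=
        integral_congr_ae (Filter.Eventually.of_forall fun g => abs_of_nonneg (hu g))
      have h := (_root_.abs_le.1 (hT.abs_le hC u)).1
      rw [e] at h
      linarith
  let τ := RealRMK.rieszMeasure Λ
  have hτ : ∀ u : C_c(G, ℝ), φ (T u) = ∫ g, u g ∂τ - C * ∫ g, u g ∂ν := fun u => by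
    have : ∫ g, u g ∂τ = φ (T u) + C * ∫ g, u g ∂ν := RealRMK.integral_rieszMeasure Λ u
    rw [this]
    ring
  have hint : ∀ σ : Measure G, [IsFiniteMeasureOnCompacts σ] →
      Integrable (fun y => ω' y * ∫ g, ω (g * y⁻¹) ∂σ) ν := fun σ _ =>
    integrable_mul_of_hasCompactSupport ω'.continuous ω'.hasCompactSupport
      (continuous_integral_translateCc σ ω)
  rw [hτ, integral_convolutionCc τ, integral_convolutionCc ν, ← integral_const_mul,
    ← integral_sub (hint τ) ((hint ν).const_mul C)]
  refine integral_congr_ae (Filter.Eventually.of_forall fun y => ?_)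
  simp only [hτ, translateCc_apply, one_mul]
  ring

end Convolution

/-! ### From a fixed mean map to a fixed point -/

section FixedPoint

open scoped CompactlySupported Pointwise

/-- A change of variables bounds the effect of a translation on averages. -/
theorem IsQuasiInvariant.abs_integral_smul_sub_le {G X : Type*} [Group G] [TopologicalSpace G]
    [TopologicalSpace X] [MulAction G X] [ContinuousConstSMul G X] [MeasurableSpace X]
    [BorelSpace X] {μ : Measure X} {lam : G → X → ℝ} (hq : IsQuasiInvariant μ lam) {p f : X → ℝ}
    (hp : Continuous p) (hpc : HasCompactSupport p) (hf : Continuous f) {C : ℝ}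
    (hC : ∀ x, |f x| ≤ C) (y : G) :
    |∫ x, p x * f (y • x) ∂μ - ∫ x, p x * f x ∂μ| ≤
      C * ∫ x, |p (y⁻¹ • x) * lam y⁻¹ x - p x| ∂μ := by
  have := hq.regular
  have hsm : Continuous fun x : X => y⁻¹ • x := continuous_const_smul y⁻¹
  have hpy : Continuous fun x => p (y⁻¹ • x) := hp.comp hsm
  have hpyc : HasCompactSupport fun x => p (y⁻¹ • x) :=
    hpc.comp_homeomorph (Homeomorph.smul y⁻¹)
  have hl := hq.continuous_right y⁻¹
  have hcov : ∫ x, p x * f (y • x) ∂μ = ∫ x, p (y⁻¹ • x) * lam y⁻¹ x * f x ∂μ := by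
    have := hq.integral_smul y⁻¹ (fun x => p (y⁻¹ • x) * f x) (hpy.mul hf) hpyc.mul_right
    simp only [inv_inv, inv_smul_smul] at this
    rw [this]
    simp only [mul_right_comm]
  have hi1 : Integrable (fun x => p (y⁻¹ • x) * lam y⁻¹ x * f x) μ :=
    integrable_mul_of_hasCompactSupport (hpy.mul hl) hpyc.mul_right hf
  have hi2 : Integrable (fun x => p x * f x) μ := integrable_mul_of_hasCompactSupport hp hpc hf
  have hi3 : Integrable (fun x => p (y⁻¹ • x) * lam y⁻¹ x - p x) μ :=
    (integrable_mul_of_hasCompactSupport hpy hpyc hl).sub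
      (hp.integrable_of_hasCompactSupport hpc)
  rw [hcov, ← integral_sub hi1 hi2, ← integral_const_mul]
  refine abs_integral_le_integral_abs.trans (integral_mono (hi1.sub hi2).abs
    (hi3.abs.const_mul C) fun x => ?_)
  simp only [← sub_mul, abs_mul]
  rw [mul_comm]
  exact mul_le_mul_of_nonneg_right (hC x) (abs_nonneg _)

/-- Translates of a density depend continuously in `L¹` on the translation. -/
theorem IsQuasiInvariant.eventually_integral_abs_sub_le {G X : Type*} [Group G]
    [TopologicalSpace G] [IsTopologicalGroup G] [LocallyCompactSpace G] [TopologicalSpace X]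
    [MulAction G X] [ContinuousSMul G X] [MeasurableSpace X] [BorelSpace X] {μ : Measure X}
    {lam : G → X → ℝ} (hq : IsQuasiInvariant μ lam) {p : X → ℝ} (hp : Continuous p)
    (hpc : HasCompactSupport p) {δ : ℝ} (hδ : 0 < δ) :
    ∀ᶠ y : G in 𝓝 1, ∫ x, |p (y⁻¹ • x) * lam y⁻¹ x - p x| ∂μ ≤ δ := by
  have := hq.regular
  obtain ⟨N, hN, hN1⟩ := exists_compact_mem_nhds (1 : G)
  have hl : Continuous fun q : G × X => lam q.1⁻¹ q.2 :=
    hq.continuous.comp (by fun_prop : Continuous fun q : G × X => (q.1⁻¹, q.2))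
  have hl1 := hq.continuous_right 1
  have hcont : ContinuousAt (fun y : G => ∫ x, |p (y⁻¹ • x) * lam y⁻¹ x - p x| ∂μ) 1 := by
    refine continuousAt_integral_of_locally_compact_support
      (F := fun (y : G) (x : X) => |p (y⁻¹ • x) * lam y⁻¹ x - p x|)
      ?_ hN1 (hN.smul_set hpc.isCompact) fun y hy x hx => ?_
    · exact (((hp.comp (by fun_prop : Continuous fun q : G × X => q.1⁻¹ • q.2)).mul hl).sub
        (hp.comp continuous_snd)).abs
    · have hpy : ∀ y ∈ N, p (y⁻¹ • x) = 0 := fun y hy => by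
        by_contra hne
        exact hx ⟨y, hy, y⁻¹ • x, subset_tsupport _ hne, by simp⟩
      have h1 := hpy 1 (mem_of_mem_nhds hN1)
      rw [inv_one, one_smul] at h1
      simp [hpy y hy, h1]
  -- `lam 1` equals `1` almost everywhere on the support of `p`
  have hzero : ∫ x, |p x * lam 1 x - p x| ∂μ = 0 := by
    have hk : Continuous fun x => p x * lam 1 x - p x := (hp.mul hl1).sub hp
    have hkc : HasCompactSupport fun x => p x * lam 1 x - p x := hpc.mul_right.sub hpc
    have h1 := hq.integral_smul 1 (fun x => p x * (p x * lam 1 x - p x)) (hp.mul hk) hpc.mul_right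
    simp only [inv_one, one_smul] at h1
    have hi1 : Integrable (fun x => p x * (p x * lam 1 x - p x)) μ :=
      integrable_mul_of_hasCompactSupport hp hpc hk
    have hi2 : Integrable (fun x => p x * (p x * lam 1 x - p x) * lam 1 x) μ :=
      integrable_mul_of_hasCompactSupport (hp.mul hk) hpc.mul_right hl1
    have h2 : ∫ x, (p x * lam 1 x - p x) * (p x * lam 1 x - p x) ∂μ = 0 := by
      rw [eq_comm, ← sub_eq_zero, ← integral_sub hi2 hi1] at h1
      rw [← h1]
      refine integral_congr_ae (Filter.Eventually.of_forall fun x => ?_)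
      ring
    rw [integral_eq_zero_iff_of_nonneg (fun x => mul_self_nonneg _)
      (integrable_mul_of_hasCompactSupport hk hkc hk)] at h2
    refine integral_eq_zero_of_ae (h2.mono fun x hx => ?_)
    exact abs_eq_zero.2 (mul_self_eq_zero.1 hx)
  refine (hcont.eventually (gt_mem_nhds ?_)).mono fun y hy => le_of_lt hy
  simpa [hzero] using hδ

variable {G : Type*} [Group G] [TopologicalSpace G] [IsTopologicalGroup G] {H : Subgroup G}
  {E : Type*}

/-- The map `G ⧸ H → E` sending the class of `g` to the value of the mean map `T` at the translate
of the density `u` by `g`; it is independent of the representative if `T` is `H`-fixed. -/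
noncomputable def quotientMap (T : C_c(G, ℝ) → E) (u : C_c(G, ℝ)) (x : G ⧸ H) : E :=
  T (translateCc 1 x.out⁻¹ u)

theorem quotientMap_mk {T : C_c(G, ℝ) → E} (hfix : ∀ k ∈ H, ∀ u, T (translateCc 1 k⁻¹ u) = T u)
    (u : C_c(G, ℝ)) (g : G) : quotientMap T u (g : G ⧸ H) = T (translateCc 1 g⁻¹ u) := by
  obtain ⟨k, hk⟩ := QuotientGroup.mk_out_eq_mul H g
  rw [quotientMap, hk, ← hfix k k.2 (translateCc 1 g⁻¹ u), translateCc_translateCc]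
  simp

/-- The `h`-conjugate of a density, normalised by the factor `c h`. -/
noncomputable def conjugateCc (c : G → ℝ) (h : G) (ω : C_c(G, ℝ)) : C_c(G, ℝ) :=
  (c h)⁻¹ • translateCc h⁻¹ h ω

theorem conjugateCc_apply (c : G → ℝ) (h : G) (ω : C_c(G, ℝ)) (g : G) :
    conjugateCc c h ω g = (c h)⁻¹ * ω (h⁻¹ * g * h) := rfl

variable [AddCommGroup E] [Module ℝ E] [MeasurableSpace G] [BorelSpace G]
  {ν : Measure G} {K : Set E} {T : C_c(G, ℝ) → E}

theorem integral_conjugateCc [ν.IsMulRightInvariant] {c : G → ℝ} (hc0 : ∀ h, 0 < c h)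
    (hc : ∀ (h : G) (u : C_c(G, ℝ)), ∫ g, u (h⁻¹ * g) ∂ν = c h * ∫ g, u g ∂ν) (h : G)
    (ω : C_c(G, ℝ)) : ∫ g, conjugateCc c h ω g ∂ν = ∫ g, ω g ∂ν := by
  simp only [conjugateCc_apply]
  have := hc h (translateCc 1 h ω)
  rw [integral_translateCc_right] at this
  simp only [translateCc_apply, one_mul] at this
  rw [integral_const_mul, this, inv_mul_cancel_left₀ (hc0 h).ne']

theorem equivariant_quotientMap [ν.IsMulRightInvariant] {c : G → ℝ} {ρ : H →* (E →ᵃ[ℝ] E)}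
    (hT : T ∈ inducedSet ν c ρ K) (hfix : ∀ k ∈ H, ∀ u, T (translateCc 1 k⁻¹ u) = T u) (h : H)
    {ω : C_c(G, ℝ)} (hω : 0 ≤ ω) (h1 : ∫ g, ω g ∂ν = 1) (x : G ⧸ H) :
    ρ h (quotientMap T ω x) = quotientMap T (conjugateCc c h ω) ((h : G) • x) := by
  induction x using QuotientGroup.induction_on with
  | H g =>
    have e : (h : G) • (g : G ⧸ H) = ((h * g : G) : G ⧸ H) := rfl
    rw [e, quotientMap_mk hfix, quotientMap_mk hfix, ← hT.2 h _ (translateCc_nonneg _ _ hω)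
      ((integral_translateCc_right ν _ _).trans h1), conjugateCc, translateCc_smul,
      translateCc_translateCc, translateCc_translateCc]
    simp

theorem IsMeanMap.quotientMap_mem [ν.IsMulRightInvariant] (hT : IsMeanMap ν K T) {ω : C_c(G, ℝ)}
    (hω : 0 ≤ ω) (h1 : ∫ g, ω g ∂ν = 1) (x : G ⧸ H) : quotientMap T ω x ∈ K :=
  hT.mem_of_integral_eq_one (translateCc_nonneg _ _ hω)
    ((integral_translateCc_right ν _ _).trans h1)

variable [TopologicalSpace E] [IsFiniteMeasureOnCompacts ν]

theorem IsMeanMap.continuous_quotientMap [LocallyCompactSpace G] (hK : IsCompact K)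
    (hT : IsMeanMap ν K T) (hfix : ∀ k ∈ H, ∀ u, T (translateCc 1 k⁻¹ u) = T u) (φ : E →L[ℝ] ℝ)
    (u : C_c(G, ℝ)) : Continuous fun x : G ⧸ H => φ (quotientMap T u x) := by
  obtain ⟨C, -, hC⟩ := exists_forall_mem_abs_le hK φ
  refine QuotientGroup.isOpenQuotientMap_mk.isQuotientMap.continuous_iff.2
    (continuous_iff_continuousAt.2 fun k₀ => ?_)
  simp only [Function.comp_def, quotientMap_mk hfix]
  refine tendsto_iff_dist_tendsto_zero.2 (squeeze_zero (fun _ => dist_nonneg) (fun k => ?_)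
    (by simpa only [mul_zero] using (tendsto_integral_abs_translateCc_sub ν u k₀).const_mul C))
  rw [Real.dist_eq, ← _root_.map_sub, ← hT.map_sub]
  exact hT.abs_le hC _

variable [ν.IsMulRightInvariant]

theorem IsMeanMap.abs_quotientMap_le (hT : IsMeanMap ν K T) {φ : E →L[ℝ] ℝ} {C : ℝ}
    (hC : ∀ x ∈ K, |φ x| ≤ C) (u : C_c(G, ℝ)) (x : G ⧸ H) :
    |φ (quotientMap T u x)| ≤ C * ∫ g, |u g| ∂ν := by
  refine (hT.abs_le hC _).trans (le_of_eq ?_)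
  congr 1
  simpa using integral_mul_right_eq_self (μ := ν) (fun g => |u g|) x.out⁻¹

variable [LocallyCompactSpace G] [MeasurableSpace (G ⧸ H)] [BorelSpace (G ⧸ H)]
  {μ : Measure (G ⧸ H)} {lam : G → G ⧸ H → ℝ}

/-- Averages over `G ⧸ H` of the maps attached to two densities are close if the densities are close
in `L¹`. -/
theorem IsMeanMap.abs_integral_quotientMap_sub_le [IsFiniteMeasureOnCompacts μ] (hK : IsCompact K)
    (hT : IsMeanMap ν K T) (hfix : ∀ k ∈ H, ∀ u, T (translateCc 1 k⁻¹ u) = T u) {φ : E →L[ℝ] ℝ}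
    {C : ℝ} (hC : ∀ x ∈ K, |φ x| ≤ C) {p : G ⧸ H → ℝ} (hp : Continuous p)
    (hpc : HasCompactSupport p) (hp0 : ∀ x, 0 ≤ p x) (hp1 : ∫ x, p x ∂μ = 1) (u v : C_c(G, ℝ)) :
    |∫ x, p x * φ (quotientMap T u x) ∂μ - ∫ x, p x * φ (quotientMap T v x) ∂μ| ≤
      C * ∫ g, |(u - v) g| ∂ν := by
  have hi : ∀ u : C_c(G, ℝ), Integrable (fun x : G ⧸ H => p x * φ (quotientMap T u x)) μ := fun u =>
    integrable_mul_of_hasCompactSupport hp hpc (hT.continuous_quotientMap hK hfix φ u)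
  have hsub : ∀ x : G ⧸ H, φ (quotientMap T u x) - φ (quotientMap T v x) =
      φ (quotientMap T (u - v) x) := fun x => by
    rw [← _root_.map_sub, quotientMap, quotientMap, ← hT.map_sub]
    rfl
  rw [← integral_sub (hi u) (hi v)]
  refine abs_integral_le_integral_abs.trans ?_
  calc ∫ x, |p x * φ (quotientMap T u x) - p x * φ (quotientMap T v x)| ∂μ
      ≤ ∫ x, p x * (C * ∫ g, |(u - v) g| ∂ν) ∂μ := by
        refine integral_mono ((hi u).sub (hi v)).abs
          ((hp.integrable_of_hasCompactSupport hpc).mul_const _) fun x => ?_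
        simp only [← mul_sub, abs_mul, abs_of_nonneg (hp0 x), hsub]
        exact mul_le_mul_of_nonneg_left (hT.abs_quotientMap_le hC _ x) (hp0 x)
    _ = C * ∫ g, |(u - v) g| ∂ν := by rw [integral_mul_const, hp1, one_mul]

variable [T2Space G] [IsClosed (H : Set G)]

/-- Convolving `ω` from the right by a probability density `ω'` amounts to averaging translates over
`G ⧸ H`, hence does not change the average of `quotientMap T ω` against `p` by much if
`p` is almost invariant under the support of `ω'`. -/
theorem IsMeanMap.abs_integral_quotientMap_convolutionCc_sub_le (hq : IsQuasiInvariant μ lam)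
    (hK : IsCompact K)
    (hT : IsMeanMap ν K T) (hfix : ∀ k ∈ H, ∀ u, T (translateCc 1 k⁻¹ u) = T u) {φ : E →L[ℝ] ℝ}
    {C : ℝ} (hC0 : 0 ≤ C) (hC : ∀ x ∈ K, |φ x| ≤ C) {p : G ⧸ H → ℝ} (hp : Continuous p)
    (hpc : HasCompactSupport p) {ω ω' : C_c(G, ℝ)} (hω : 0 ≤ ω) (hω1 : ∫ g, ω g ∂ν = 1)
    (hω' : 0 ≤ ω') (hω'1 : ∫ g, ω' g ∂ν = 1) {δ : ℝ}
    (hδ : ∀ y, ω' y ≠ 0 → ∫ x, |p (y⁻¹ • x) * lam y⁻¹ x - p x| ∂μ ≤ δ) :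
    |∫ x, p x * φ (quotientMap T (convolutionCc ν ω ω') x) ∂μ -
      ∫ x, p x * φ (quotientMap T ω x) ∂μ| ≤ C * δ := by
  have := hq.regular
  set f : G ⧸ H → ℝ := fun x => φ (quotientMap T ω x) with hf
  have hfcont : Continuous f := hT.continuous_quotientMap hK hfix φ ω
  have hfC : ∀ x, |f x| ≤ C := fun x => hC _ (hT.quotientMap_mem hω hω1 x)
  have hconv : ∀ x : G ⧸ H,
      φ (quotientMap T (convolutionCc ν ω ω') x) = ∫ y, ω' y * f (y • x) ∂ν := fun x => by
    induction x using QuotientGroup.induction_on with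
    | H g =>
      rw [quotientMap_mk hfix, translateCc_convolutionCc, hT.apply_convolutionCc hK,
        ← integral_mul_right_eq_self _ g]
      refine integral_congr_ae (Filter.Eventually.of_forall fun y => ?_)
      have e : y • (g : G ⧸ H) = ((y * g : G) : G ⧸ H) := rfl
      simp only [hf, e, quotientMap_mk hfix, translateCc_apply, one_mul, mul_inv_cancel_right]
  set I : G → ℝ := fun y => ∫ x, p x * f (y • x) ∂μ with hI
  have hswap : ∫ x, p x * φ (quotientMap T (convolutionCc ν ω ω') x) ∂μ = ∫ y, ω' y * I y ∂ν := by
    have h1 := integral_integral_swap_of_hasCompactSupport (μ := μ) (ν := ν)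
      (f := fun (x : G ⧸ H) (y : G) => p x * (ω' y * f (y • x)))
      (by unfold Function.uncurry; fun_prop)
      (HasCompactSupport.intro (hpc.isCompact.prod ω'.hasCompactSupport.isCompact) fun q hq => by
        by_cases hx : q.1 ∈ tsupport p
        · have hy : q.2 ∉ tsupport ω' := fun h => hq ⟨hx, h⟩
          simp [Function.uncurry, image_eq_zero_of_notMem_tsupport hy]
        · simp [Function.uncurry, image_eq_zero_of_notMem_tsupport hx])
    simp only [hconv, ← integral_const_mul]
    rw [h1]
    simp only [hI, ← integral_const_mul, mul_left_comm (p _)]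
  have hIcont : Continuous I := continuous_iff_continuousAt.2 fun y₀ =>
    continuousAt_integral_of_locally_compact_support
      (F := fun (y : G) (x : G ⧸ H) => p x * f (y • x))
      (by unfold Function.uncurry; fun_prop) Filter.univ_mem hpc.isCompact fun y _ x hx => by
        rw [image_eq_zero_of_notMem_tsupport hx, zero_mul]
  have hi : Integrable (fun y => ω' y * I y) ν :=
    integrable_mul_of_hasCompactSupport ω'.continuous ω'.hasCompactSupport hIcont
  have hJ : ∫ x, p x * f x ∂μ = ∫ y, ω' y * ∫ x, p x * f x ∂μ ∂ν := by
    rw [integral_mul_const, hω'1, one_mul]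
  rw [hswap, hJ, ← integral_sub hi ((ω'.integrable' ν).mul_const _)]
  refine abs_integral_le_integral_abs.trans ?_
  calc ∫ y, |ω' y * I y - ω' y * ∫ x, p x * f x ∂μ| ∂ν ≤ ∫ y, ω' y * (C * δ) ∂ν := by
        refine integral_mono (hi.sub ((ω'.integrable' ν).mul_const _)).abs
          ((ω'.integrable' ν).mul_const _) fun y => ?_
        simp only [← mul_sub, abs_mul, abs_of_nonneg (hω' y)]
        by_cases hy : ω' y = 0
        · simp [hy]
        · exact mul_le_mul_of_nonneg_left ((hq.abs_integral_smul_sub_le hp hpc hfcont hfC y).trans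
            (mul_le_mul_of_nonneg_left (hδ y hy) hC0)) (hω' y)
    _ = C * δ := by rw [integral_mul_const, hω'1, one_mul]

/-- A closed subgroup which is relatively amenable and satisfies Derighetti's condition is amenable.
Relative amenability yields an `H`-fixed mean map in the space induced from `K`, which
is averaged over `G ⧸ H` against an almost `H`-invariant density. -/
theorem IsRelativelyAmenable.isAmenableGroup {G : Type u} [Group G] [TopologicalSpace G]
    [IsTopologicalGroup G] [LocallyCompactSpace G] [T2Space G] {H : Subgroup G}
    (hH : IsClosed (H : Set G)) (hrel : IsRelativelyAmenable H) (hD : DerighettiCondition H) :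
    IsAmenableGroup H := by
  intro E _ _ _ _ _ _ _ ρ K hK hKn
  classical
  borelize G
  let : MeasurableSpace (G ⧸ H) := borel (G ⧸ H)
  have : BorelSpace (G ⧸ H) := ⟨rfl⟩
  have : IsClosed (H : Set G) := hH
  obtain ⟨μ, lam, hq, hL⟩ := hD
  have := hq.regular
  obtain ⟨ν, c, _, _, _, hc0, hc⟩ := exists_right_haar G
  obtain ⟨T, hT, hTfix⟩ := hrel (C_c(G, ℝ) → E) (inducedAction G E) (inducedSet ν c ρ K)
    (isConvexCompactGSpace_inducedSet ν c hK) (inducedSet_nonempty hc0 hc hH hK hKn)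
  have hfix : ∀ k ∈ H, ∀ u, T (translateCc 1 k⁻¹ u) = T u := fun k hk u =>
    congrFun (hTfix k hk) u
  have hTm := hT.1
  refine exists_fixed_of_approx hK.isCompact ρ hK.continuous_apply fun s t ε hε => ?_
  obtain ⟨C, hC0, hC⟩ : ∃ C : ℝ, 0 ≤ C ∧ ∀ φ ∈ t, ∀ x ∈ K, |φ x| ≤ C := by
    choose C hC0 hC using fun φ : E →L[ℝ] ℝ => exists_forall_mem_abs_le hK.isCompact φ
    exact ⟨∑ φ ∈ t, C φ, Finset.sum_nonneg fun φ _ => hC0 φ, fun φ hφ x hx =>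
      (hC φ x hx).trans (Finset.single_le_sum (f := C) (fun φ _ => hC0 φ) hφ)⟩
  obtain ⟨δ, hδ0, hδε⟩ : ∃ δ : ℝ, 0 < δ ∧ 5 * (C * δ) ≤ ε := by
    refine ⟨ε / (5 * (C + 1)), by positivity, ?_⟩
    have : 5 * (C * (ε / (5 * (C + 1)))) = ε * (C / (C + 1)) := by field_simp
    rw [this]
    exact mul_le_of_le_one_right hε.le ((div_le_one (by linarith)).2 (by linarith))
  -- an almost invariant probability density on `G ⧸ H`
  obtain ⟨p, hp, hpc, hp0, hp1, hpS⟩ := hq.exists_almost_invariant_density ((↑) '' (s : Set H))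
    (fun η hη => hL _ (by rintro _ ⟨h, -, rfl⟩; exact h.2) (s.finite_toSet.image _).isCompact η hη)
    hδ0
  -- `ω'` is chosen according to `p`, and then `ω` according to `ω'`
  obtain ⟨ω', hω', -, hω'1, hω'V⟩ := exists_symmetric_density ν
    (hq.eventually_integral_abs_sub_le hp hpc hδ0)
  obtain ⟨V, hV, hVω⟩ := exists_nhds_integral_abs_convolutionCc_sub_le (ν := ν) ω' hδ0
  -- the support of `ω` has to be so small that the conjugates of `ω` by `s` live in `V` as well
  have hW : V ∩ ⋂ h ∈ s, {g : G | (h : G) * g * (h : G)⁻¹ ∈ V} ∈ 𝓝 (1 : G) := by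
    refine Filter.inter_mem hV ((Filter.biInter_finset_mem s).2 fun h _ => ?_)
    have : ContinuousAt (fun g : G => (h : G) * g * (h : G)⁻¹) 1 := by fun_prop
    exact this.preimage_mem_nhds (by simpa using hV)
  obtain ⟨ω, hω, hωs, hω1, hωW⟩ := exists_symmetric_density ν hW
  obtain ⟨y, hyK, hy⟩ := exists_weak_integral hK.convex hK.isCompact hKn μ
    (hTm.quotientMap_mem hω hω1) (fun φ => hTm.continuous_quotientMap hK.isCompact hfix φ ω)
    hp hpc hp0
  simp only [hp1, one_smul] at hy
  refine ⟨y, hyK, fun h hh φ hφ => ?_⟩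
  set ωh := conjugateCc c h ω with hωh
  have hωh0 : 0 ≤ ωh := fun g => mul_nonneg (inv_nonneg.2 (hc0 h).le) (hω _)
  have hωh1 : ∫ g, ωh g ∂ν = 1 := (integral_conjugateCc hc0 hc h ω).trans hω1
  have hωhs : ∀ g, ωh g⁻¹ = ωh g := fun g => by
    rw [hωh, conjugateCc_apply, conjugateCc_apply, ← hωs]
    simp [mul_assoc]
  have hωhV : ∀ g, ωh g ≠ 0 → g ∈ V := fun g hg => by
    have h1 : ω ((h : G)⁻¹ * g * h) ≠ 0 := fun h0 =>
      hg (by rw [hωh, conjugateCc_apply, h0, mul_zero])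
    simpa [mul_assoc] using mem_iInter₂.1 (hωW _ h1).2 h hh
  -- both `M ω` and `M ωh` are close to `M ω'`, by comparison with the convolutions with `ω'`
  let M : C_c(G, ℝ) → ℝ := fun u => ∫ x, p x * φ (quotientMap T u x) ∂μ
  have hM : ∀ u : C_c(G, ℝ), 0 ≤ u → (∀ g, u g⁻¹ = u g) → ∫ g, u g ∂ν = 1 →
      (∀ g, u g ≠ 0 → g ∈ V) → |M u - M ω'| ≤ 2 * (C * δ) := fun u hu hus hu1 huV => by
    have h1 : |M (convolutionCc ν u ω') - M u| ≤ C * δ :=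
      hTm.abs_integral_quotientMap_convolutionCc_sub_le hq hK.isCompact hfix hC0 (hC φ hφ) hp hpc
        hu hu1 hω' hω'1 fun y hy => hω'V y hy
    have h2 : |M (convolutionCc ν u ω') - M ω'| ≤ C * δ :=
      (hTm.abs_integral_quotientMap_sub_le hK.isCompact hfix (hC φ hφ) hp hpc hp0 hp1 _ _).trans
        (mul_le_mul_of_nonneg_left (hVω u hu hus hu1 huV) hC0)
    rw [abs_le] at h1 h2 ⊢
    constructor <;> linarith
  have hMω := hM ω hω hωs hω1 fun g hg => (hωW g hg).1
  have hMωh := hM ωh hωh0 hωhs hωh1 hωhV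
  have hshift : φ (ρ h y) = ∫ x, p x * φ (quotientMap T ωh ((h : G) • x)) ∂μ := by
    obtain ⟨ψ, a, hψ⟩ := exists_functional_comp_affine φ (ρ h) (hK.continuous_apply h)
    have hi : Integrable (fun x => p x * ψ (quotientMap T ω x)) μ :=
      integrable_mul_of_hasCompactSupport hp hpc
        (hTm.continuous_quotientMap hK.isCompact hfix ψ ω)
    have ha : a = ∫ x, p x * a ∂μ := by rw [integral_mul_const, hp1, one_mul]
    rw [hψ, hy, ha, ← integral_add hi ((hp.integrable_of_hasCompactSupport hpc).mul_const a)]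
    refine integral_congr_ae (Filter.Eventually.of_forall fun x => ?_)
    simp only
    rw [hωh, ← equivariant_quotientMap hT hfix h hω hω1 x, hψ, mul_add]
  have hinv : |φ (ρ h y) - M ωh| ≤ C * δ := by
    rw [hshift]
    refine (hq.abs_integral_smul_sub_le hp hpc
      (hTm.continuous_quotientMap hK.isCompact hfix φ ωh)
      (fun x => hC φ hφ _ (hTm.quotientMap_mem hωh0 hωh1 x)) (h : G)).trans ?_
    exact mul_le_mul_of_nonneg_left (hpS h ⟨h, hh, rfl⟩) hC0
  have hyM : φ y = M ω := hy φ
  rw [hyM]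
  rw [abs_le] at hinv hMω hMωh ⊢
  constructor <;> linarith

end FixedPoint

theorem mainTheorem5 {G : Type*} [Group G] [TopologicalSpace G] [IsTopologicalGroup G]
    [LocallyCompactSpace G] [T2Space G] (H : ClosedSubgroup G) :
    (H ∈ closure {L : ClosedSubgroup G | IsAmenableGroup L.toSubgroup} →
      (InClassX G ∨ DerighettiCondition H.toSubgroup) → IsAmenableGroup H.toSubgroup) ∧
    (IsOpen (H : Set G) ∨ H.toSubgroup.Normal → DerighettiCondition H.toSubgroup) := by
  refine ⟨fun hH h => ?_, fun h => ?_⟩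
  · have hrel := isRelativelyAmenable_of_mem_closure hH
    exact h.elim (fun hX => hX H hrel) fun hD => hrel.isAmenableGroup H.isClosed' hD
  · exact h.elim (derighettiCondition_of_isOpen _) (derighettiCondition_of_normal _ H.isClosed')
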